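/- Let $n\ge 1$, $0<m<1$, $R>0$, let $B_R$ be the open ball of radius $R$ about the origin in $\mathbb R^n$, $\omega_n=|B_1|$, $R_v=\omega_nR^n$, and let $V\in W^{2,\infty}(B_R)$ (i.e. $V$, in its continuous representative, is differentiable in $B_R$ with Lipschitz gradient) be radially symmetric. Regard $V$ as a function of the volume variable $v=\omega_n|x|^n\in(0,R_v)$ and consider the mass equation $$\frac{\partial M}{\partial t}=\kappa(v)^2\left\{\frac{\partial}{\partial v}\left[\Big(\frac{\partial M}{\partial v}\Big)^m\right]+\frac{\partial M}{\partial v}\frac{\partial V}{\partial v}\right\},\qquad \kappa(v)=n\,\omega_n^{1/n}v^{\frac{n-1}{n}},$$ in $(0,\infty)\times(0,R_v)$, where $s^m$ means $|s|^{m-1}s$ for $s<0$. A function $M$ is a viscosity supersolution if for every $t_0>0$, $v_0\in(0,R_v)$, every $\varepsilon>0$ with $Q_\varepsilon=(t_0-\varepsilon,t_0+\varepsilon)\times(v_0-\varepsilon,v_0+\varepsilon)\subset(0,\infty)\times(0,R_v)$ and every $\varphi\in C^2(Q_\varepsilon)$ with $\varphi\le M$ in $Q_\varepsilon$, $\varphi(t_0,v_0)=M(t_0,v_0)$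 and $\frac{\partial\varphi}{\partial v}(t_0,v)\ne0$ for all $v\neq v_0$, one has $$\limsup_{v\to v_0,\ v\ne v_0}\left(\frac{\partial\varphi}{\partial t}(t_0,v_0)-\kappa(v_0)^2\left\{\frac{\partial}{\partial v}\left[\Big(\frac{\partial\varphi}{\partial v}\Big)^m\right](t_0,v)+\frac{\partial\varphi}{\partial v}(t_0,v_0)\frac{\partial V}{\partial v}(v_0)\right\}\right)\ge0 .$$ It is a viscosity subsolution if, for all such $\varphi$ with $\varphi\ge M$ in place of $\varphi\le M$, the corresponding $\liminf$ is $\le0$. **Theorem (comparison principle of viscosity solutions if $\rho$ is bounded below).** Let $\underline M,\overline M:[0,\infty)\times[0,R_v]\to\mathbb R$ be uniformly continuous, $\underline M$ a viscosity subsolution and $\overline M$ a viscosity supersolution of the mass equation, ordered initially and on the lateral boundary: $$\underline M(0,v)\le\overline M(0,v)\ \ (0\le v\le R_v),\qquad \underline M(t,0)\le\overline M(t,0),\quad \underline M(t,R_v)\le\overline M(t,R_v)\ \ (t>0).$$ Assume that there is $C_0>0$ such that $$\underline M(t,v_2)-\underline M(t,v_1)\ge C_0(v_2-v_1)\qquad\text{for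 all }t\ge0,\ 0\le v_1\le v_2\le R_v .$$ Then $\underline M\le\overline M$ on $[0,\infty)\times[0,R_v]$. -/

import Mathlib

open Set Filter Topology MeasureTheory

noncomputable section

namespace MassEq

/-- The volume `ω_n = |B_1|` of the unit ball of `ℝⁿ`. -/
def unitBallVol (n : ℕ) : ℝ :=
  (volume (Metric.ball (0 : EuclideanSpace ℝ (Fin n)) 1)).toReal

/-- The volume `R_v = Rⁿ |B_1|` of the ball of radius `R`. -/
def ballVol (n : ℕ) (R : ℝ) : ℝ := R ^ n * unitBallVol n

/-- The weight `κ(v) = n ω_n^{1/n} v^{(n-1)/n}`. -/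
def kappa (n : ℕ) (v : ℝ) : ℝ :=
  n * unitBallVol n ^ (1 / (n : ℝ)) * v ^ (((n : ℝ) - 1) / n)

/-- The signed power `|s|^{m-1} s`, which is `s ^ m` for `s > 0`. -/
def signedPow (m s : ℝ) : ℝ := |s| ^ (m - 1) * s

/-- `V` is radially symmetric on the open ball `B_R`. -/
def IsRadialOn {n : ℕ} (R : ℝ) (V : EuclideanSpace ℝ (Fin n) → ℝ) : Prop :=
  ∀ x ∈ Metric.ball (0 : EuclideanSpace ℝ (Fin n)) R,
    ∀ y ∈ Metric.ball (0 : EuclideanSpace ℝ (Fin n)) R, ‖x‖ = ‖y‖ → V x = V y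

/-- `V ∈ W^{2,∞}(B_R)`, for the continuous representative: on the (convex) ball this means that
`V` is differentiable with Lipschitz gradient. -/
def IsW2Infty {n : ℕ} (R : ℝ) (V : EuclideanSpace ℝ (Fin n) → ℝ) : Prop :=
  DifferentiableOn ℝ V (Metric.ball 0 R) ∧
    ∃ K : NNReal, LipschitzOnWith K (fderiv ℝ V) (Metric.ball 0 R)

/-- A radial potential in the volume variable: the value of `V` at the points `x` with
`v = |B_1| |x|ⁿ`, represented by a point on the first coordinate axis. -/
def volPotential {n : ℕ} [NeZero n] (V : EuclideanSpace ℝ (Fin n) → ℝ) (v : ℝ) : ℝ :=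
  V (EuclideanSpace.single 0 ((v / unitBallVol n) ^ (1 / (n : ℝ))))

/-- The residual of the mass equation at `(t₀, v₀)`,
`φ_t(t₀,v₀) - κ(v₀)² { ∂_v[(φ_v)^m](t₀,v) + φ_v(t₀,v₀) V_v(v₀) }`,
with the diffusion term evaluated at a nearby `v`. -/
def massResidual {n : ℕ} [NeZero n] (m : ℝ) (V : EuclideanSpace ℝ (Fin n) → ℝ)
    (φ : ℝ → ℝ → ℝ) (t₀ v₀ v : ℝ) : ℝ :=
  deriv (fun t => φ t v₀) t₀ - kappa n v₀ ^ 2 *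
    (deriv (fun w => signedPow m (deriv (φ t₀) w)) v
      + deriv (φ t₀) v₀ * deriv (volPotential V) v₀)

/-- The open box `(t₀ - ε, t₀ + ε) × (v₀ - ε, v₀ + ε)`. -/
def box (t₀ v₀ ε : ℝ) : Set (ℝ × ℝ) :=
  Ioo (t₀ - ε) (t₀ + ε) ×ˢ Ioo (v₀ - ε) (v₀ + ε)

/-- `φ` is an admissible test function at `(t₀, v₀)` on the box of half-width `ε`, which lies in
`(0,∞) × (0,R_v)`: it is `C²` and `φ_v(t₀, v) ≠ 0` for `v ≠ v₀`. -/
structure IsTestFunction (n : ℕ) (R t₀ v₀ ε : ℝ) (φ : ℝ → ℝ → ℝ) : Prop where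
  pos : 0 < ε
  subset : box t₀ v₀ ε ⊆ Ioi 0 ×ˢ Ioo 0 (ballVol n R)
  contDiffOn : ContDiffOn ℝ 2 (fun p : ℝ × ℝ => φ p.1 p.2) (box t₀ v₀ ε)
  deriv_ne_zero : ∀ v ∈ Ioo (v₀ - ε) (v₀ + ε), v ≠ v₀ → deriv (φ t₀) v ≠ 0

/-- Viscosity supersolutions of the mass equation on `(0,∞) × (0,R_v)`
(test functions touch from below). -/
def IsViscositySupersolution {n : ℕ} [NeZero n] (m R : ℝ)
    (V : EuclideanSpace ℝ (Fin n) → ℝ) (M : ℝ → ℝ → ℝ) : Prop :=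
  ∀ (t₀ v₀ ε : ℝ) (φ : ℝ → ℝ → ℝ), IsTestFunction n R t₀ v₀ ε φ →
    (∀ p ∈ box t₀ v₀ ε, φ p.1 p.2 ≤ M p.1 p.2) → M t₀ v₀ = φ t₀ v₀ →
    (0 : EReal) ≤ limsup (fun v => (massResidual m V φ t₀ v₀ v : EReal)) (𝓝[≠] v₀)

/-- Viscosity subsolutions of the mass equation on `(0,∞) × (0,R_v)`
(test functions touch from above). -/
def IsViscositySubsolution {n : ℕ} [NeZero n] (m R : ℝ)
    (V : EuclideanSpace ℝ (Fin n) → ℝ) (M : ℝ → ℝ → ℝ) : Prop :=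
  ∀ (t₀ v₀ ε : ℝ) (φ : ℝ → ℝ → ℝ), IsTestFunction n R t₀ v₀ ε φ →
    (∀ p ∈ box t₀ v₀ ε, M p.1 p.2 ≤ φ p.1 p.2) → M t₀ v₀ = φ t₀ v₀ →
    liminf (fun v => (massResidual m V φ t₀ v₀ v : EReal)) (𝓝[≠] v₀) ≤ 0

end MassEq

end

/-! Suppose `Msub - Msup` equals σ > 0 somewhere. Subtracting an increasing exponential of time
makes the subsolution strict and rules out a maximum at the final time; uniform continuity and the
ordering on the parabolic boundary rule out maxima near the other sides. So the maximum lies inside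
a box that avoids `v = 0` and `v = R_v`, where the coefficients are Lipschitz, and
`false_of_interior_max` excludes this by doubling the variables.

Two devices keep the doubling simple. First, in the variable `Y` with `Y' = κ^{-2/(m+1)}` the
diffusion term becomes `m p^{m-1} X` with no factor depending on `v`. Hence, when both jets carry
the same number `X`, the second order terms cancel except for the small difference `q` of the
slopes. Second, the lower slope bound on `Msub` forces `p ≥ c > 0` in every test parabola, so that
test functions are admissible and `p^{m-1}` is smooth in the relevant range. What is left is `|v₁ -
v₂| p`, of order `δ p²`, which the penalization makes small.

The common `X` comes from `exists_doubling_jets`. Partial maximization of the doubled functional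
gives a sup-convolution `U` of `u` and the function `Φ` of the intermediate point `z`. At a maximum
`z(q)` of `Φ - q·z` both are squeezed between paraboloids. The slope of `Φ` there is `q`, so `z` has
a Lipschitz left inverse and the maximum points fill a set of positive measure. On that set the
slopes of `U` are Lipschitz, and Rademacher's theorem with a density argument
(`ae_second_order_expansion`) yields a second order expansion of `U` at some `z(q)`. It transfers to
`u` from above and to `w` from below. -/

noncomputable section

namespace MassEq

/-! ### Second order differentiability at points of contact with paraboloids -/

/-- The Euclidean inner product of two points of the plane. -/
def dot (a b : ℝ × ℝ) : ℝ := a.1 * b.1 + a.2 * b.2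

lemma abs_dot_le (a b : ℝ × ℝ) : |dot a b| ≤ 2 * (‖a‖ * ‖b‖) := by
  have h1 : |a.1 * b.1| ≤ ‖a‖ * ‖b‖ := by
    rw [abs_mul]
    exact mul_le_mul (norm_fst_le a) (norm_fst_le b) (abs_nonneg _) (norm_nonneg _)
  have h2 : |a.2 * b.2| ≤ ‖a‖ * ‖b‖ := by
    rw [abs_mul]
    exact mul_le_mul (norm_snd_le a) (norm_snd_le b) (abs_nonneg _) (norm_nonneg _)
  calc |dot a b| ≤ |a.1 * b.1| + |a.2 * b.2| := abs_add_le _ _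
    _ ≤ 2 * (‖a‖ * ‖b‖) := by linarith

lemma dot_add_left (a b c : ℝ × ℝ) : dot (a + b) c = dot a c + dot b c := by
  simp [dot]; ring

lemma dot_sub_left (a b c : ℝ × ℝ) : dot (a - b) c = dot a c - dot b c := by
  simp [dot]; ring

lemma dot_add_right (a b c : ℝ × ℝ) : dot a (b + c) = dot a b + dot a c := by
  simp [dot]; ring

lemma dot_sub_right (a b c : ℝ × ℝ) : dot a (b - c) = dot a b - dot a c := by
  simp [dot]; ring

lemma dot_smul_left (s : ℝ) (a b : ℝ × ℝ) : dot (s • a) b = s * dot a b := by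
  simp [dot]; ring

lemma dot_smul_right (s : ℝ) (a b : ℝ × ℝ) : dot a (s • b) = s * dot a b := by
  simp [dot]; ring

/-- The slopes of second order affine approximations of `f` at two points differ by at most a
constant multiple of their distance. -/
lemma norm_sub_le_of_quadratic_bound {f : ℝ × ℝ → ℝ} {x y a b : ℝ × ℝ} {C : ℝ} (hC : 0 ≤ C)
    (hx : ∀ z, |f z - f x - dot a (z - x)| ≤ C * ‖z - x‖ ^ 2)
    (hy : ∀ z, |f z - f y - dot b (z - y)| ≤ C * ‖z - y‖ ^ 2) :
    ‖a - b‖ ≤ 6 * C * ‖x - y‖ := by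
  -- A radius strictly above the distance also covers `x = y`. Evaluating at `y + e` with `‖e‖ = s`
  -- costs `4C s²` and `C s²`, evaluating at `y` another `C s²`: hence the 6.
  have main : ∀ s > ‖x - y‖, ‖a - b‖ ≤ 6 * C * s := by
    intro s hs
    have hpos : 0 < s := (norm_nonneg _).trans_lt hs
    have key : ∀ e : ℝ × ℝ, ‖e‖ = s → |dot (a - b) e| ≤ 6 * C * s ^ 2 := by
      intro e he
      have h1 := hx (y + e)
      have h2 := hy (y + e)
      have h3 := hx y
      have hs' : ‖y - x‖ ≤ s := by rw [norm_sub_rev]; exact hs.le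
      have e1 : y + e - x = (y - x) + e := by abel
      have n1 : ‖y + e - x‖ ≤ 2 * s := by
        rw [e1]
        calc _ ≤ ‖y - x‖ + ‖e‖ := norm_add_le _ _
          _ ≤ 2 * s := by rw [he]; linarith
      have n1' : ‖y + e - x‖ ^ 2 ≤ 4 * s ^ 2 := by nlinarith [norm_nonneg (y + e - x)]
      have n3' : ‖y - x‖ ^ 2 ≤ s ^ 2 := pow_le_pow_left₀ (norm_nonneg _) hs' 2
      have n2 : y + e - y = e := by abel
      have h1' := h1.trans (mul_le_mul_of_nonneg_left n1' hC)
      have h3' := h3.trans (mul_le_mul_of_nonneg_left n3' hC)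
      rw [n2, he] at h2
      rw [e1, dot_add_right] at h1'
      rw [dot_sub_left]
      rw [abs_le] at *
      constructor <;> linarith [h1'.1, h1'.2, h2.1, h2.2, h3'.1, h3'.2]
    have k1 := key (s, 0) (by simp [Prod.norm_def, abs_of_pos hpos, hpos.le])
    have k2 := key (0, s) (by simp [Prod.norm_def, abs_of_pos hpos, hpos.le])
    simp only [dot, mul_zero, add_zero, zero_add, abs_mul, abs_of_pos hpos] at k1 k2
    rw [Prod.norm_def, max_le_iff, Real.norm_eq_abs, Real.norm_eq_abs]
    constructor
    · exact le_of_mul_le_mul_right (by linarith) hpos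
    · exact le_of_mul_le_mul_right (by linarith) hpos
  have hlim : Tendsto (fun s => 6 * C * s) (𝓝[>] ‖x - y‖) (𝓝 (6 * C * ‖x - y‖)) :=
    (tendsto_id.mono_left nhdsWithin_le_nhds).const_mul _
  exact ge_of_tendsto hlim (eventually_mem_nhdsWithin.mono main)

/-- If `f` is approximated to second order by affine functions at the points of `K`, then their
slopes are Lipschitz on `K`. -/
lemma lipschitzOnWith_of_quadratic_bound {f : ℝ × ℝ → ℝ} {G : ℝ × ℝ → ℝ × ℝ} {K : Set (ℝ × ℝ)}
    {C : NNReal} (h : ∀ x ∈ K, ∀ y, |f y - f x - dot (G x) (y - x)| ≤ C * ‖y - x‖ ^ 2) :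
    LipschitzOnWith (6 * C) G K := by
  refine LipschitzOnWith.of_dist_le_mul fun x hx y hy => ?_
  rw [dist_eq_norm, dist_eq_norm]
  exact norm_sub_le_of_quadratic_bound C.2 (h x hx) (h y hy)

lemma le_of_forall_le_pow_add {a C b θ : ℝ} (h0 : 0 ≤ θ) (h1 : θ < 1)
    (h : ∀ N : ℕ, a ≤ C * θ ^ N + b) : a ≤ b := by
  have ht : Tendsto (fun N : ℕ => C * θ ^ N + b) atTop (𝓝 (C * 0 + b)) :=
    ((tendsto_pow_atTop_nhds_zero_of_lt_one h0 h1).const_mul C).add_const b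
  simpa using ge_of_tendsto' ht h

/-- A function that nearly scales to its own value at `θ y` is small of second order. -/
lemma abs_le_of_scaling {g : ℝ × ℝ → ℝ} {θ A B ρ : ℝ} (h0 : 0 < θ) (h1 : θ < 1)
    (hB : 0 ≤ B) (hg : ∀ y, ‖y‖ < ρ → |g y| ≤ A * ‖y‖ ^ 2)
    (hs : ∀ y, ‖y‖ < ρ → |g y - g (θ • y)| ≤ B * (1 - θ) ^ 2 * ‖y‖ ^ 2) (y : ℝ × ℝ)
    (hy : ‖y‖ < ρ) : |g y| ≤ B * (1 - θ) * ‖y‖ ^ 2 := by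
  have key : ∀ N : ℕ, ∀ y, ‖y‖ < ρ → |g y| ≤ (A * (θ ^ 2) ^ N + B * (1 - θ)) * ‖y‖ ^ 2 := by
    intro N
    induction N with
    | zero =>
      intro y hy
      refine (hg y hy).trans (mul_le_mul_of_nonneg_right ?_ (sq_nonneg _))
      have := mul_nonneg hB (sub_nonneg.2 h1.le)
      simpa using this
    | succ N ih =>
      intro y hy
      have hn : ‖θ • y‖ = θ * ‖y‖ := by rw [norm_smul, Real.norm_eq_abs, abs_of_pos h0]
      have hy' : ‖θ • y‖ < ρ := by
        rw [hn]; nlinarith [norm_nonneg y]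
      have i1 := ih _ hy'
      have i2 := hs y hy
      rw [hn] at i1
      have i3 : |g y| ≤ |g y - g (θ • y)| + |g (θ • y)| := by
        simpa using abs_add_le (g y - g (θ • y)) (g (θ • y))
      have i4 : 0 ≤ B * (1 - θ) * (1 - θ ^ 2 - (1 - θ)) :=
        mul_nonneg (mul_nonneg hB (by linarith)) (by nlinarith)
      have i5 := mul_nonneg i4 (sq_nonneg ‖y‖)
      rw [pow_succ]
      nlinarith
  refine le_of_forall_le_pow_add (C := A * ‖y‖ ^ 2) (sq_nonneg θ) (by nlinarith) fun N => ?_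
  linarith [key N y hy]

/-- Near almost every point `x` of `K`, the set `K` comes within `o(‖y‖)` of `x + y`. -/
lemma ae_exists_mem_near (K : Set (ℝ × ℝ)) :
    ∀ᵐ x, x ∈ K → ∀ k : ℕ, ∀ᶠ y in 𝓝 (0 : ℝ × ℝ), y ≠ 0 →
      ∃ z ∈ K, ‖z - (x + y)‖ ≤ 1 / ((k : ℝ) + 1) * ‖y‖ := by
  have : ∀ᵐ x, ∀ k : ℕ, x ∈ K → ∀ᶠ y in 𝓝 (0 : ℝ × ℝ), y ≠ 0 →
    ∃ z ∈ K, ‖z - (x + y)‖ ≤ 1 / ((k : ℝ) + 1) * ‖y‖ := by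
    rw [ae_all_iff]
    intro k
    -- Lebesgue density along balls not centred at `x`: the ball about `x + y` has radius
    -- `‖y‖/(k+1)`, so `x` lies within `k + 1` radii of its centre. If it missed `K`, the density
    -- ratio would be 0 instead of close to 1.
    have := IsUnifLocDoublingMeasure.ae_tendsto_measure_inter_div
      (volume : Measure (ℝ × ℝ)) K (k + 1)
    have := ae_imp_of_ae_restrict this
    filter_upwards [this] with x hx hxK
    have hk : (0 : ℝ) < k + 1 := by positivity
    have hlim := hx hxK (l := 𝓝[≠] (0 : ℝ × ℝ)) (fun y => x + y)
      (fun y => 1 / ((k : ℝ) + 1) * ‖y‖) ?_ ?_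
    · have := hlim.eventually (lt_mem_nhds (a := 0) (by simp))
      rw [eventually_nhdsWithin_iff] at this
      filter_upwards [this] with y hy hy0
      have hne := hy hy0
      by_contra hcon
      push Not at hcon
      have : K ∩ Metric.closedBall (x + y) (1 / ((k : ℝ) + 1) * ‖y‖) = ∅ := by
        ext z
        simp only [mem_inter_iff, Metric.mem_closedBall, dist_eq_norm, mem_empty_iff_false,
          iff_false, not_and, not_le]
        exact hcon z
      rw [this] at hne
      simp at hne
    · rw [tendsto_nhdsWithin_iff]
      constructor
      · have : Tendsto (fun y : ℝ × ℝ => 1 / ((k : ℝ) + 1) * ‖y‖) (𝓝 0)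
            (𝓝 (1 / ((k : ℝ) + 1) * ‖(0 : ℝ × ℝ)‖)) :=
          (continuous_const.mul continuous_norm).tendsto _
        simpa using this.mono_left nhdsWithin_le_nhds
      · filter_upwards [self_mem_nhdsWithin] with y hy
        have : 0 < ‖y‖ := norm_pos_iff.2 hy
        exact mem_Ioi.2 (by positivity)
    · refine Eventually.of_forall fun y => ?_
      rw [Metric.mem_closedBall, dist_eq_norm]
      have : x - (x + y) = -y := by abel
      rw [this, norm_neg]
      field_simp
      exact le_rfl
  filter_upwards [this] with x hx hxK k using hx k hxK

/-- **Alexandrov's theorem on a contact set.** If `f` is approximated to second order by affine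
functions at the points of `K`, then it is twice differentiable at almost every point of `K`. -/
lemma ae_second_order_expansion {f : ℝ × ℝ → ℝ} {G : ℝ × ℝ → ℝ × ℝ} {K : Set (ℝ × ℝ)}
    {C : NNReal} (h : ∀ x ∈ K, ∀ y, |f y - f x - dot (G x) (y - x)| ≤ C * ‖y - x‖ ^ 2) :
    ∀ᵐ x, x ∈ K → ∃ A : ℝ × ℝ →L[ℝ] ℝ × ℝ, ∀ η > 0, ∀ᶠ y in 𝓝 (0 : ℝ × ℝ),
      |f (x + y) - f x - dot (G x) y - 1 / 2 * dot (A y) y| ≤ η * ‖y‖ ^ 2 := by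
  have hdens := ae_exists_mem_near K
  have hrad := (lipschitzOnWith_of_quadratic_bound h).ae_differentiableWithinAt_of_mem
    (μ := volume)
  filter_upwards [hdens, hrad] with x hx1 hx2 hxK
  obtain ⟨A, hA⟩ := hx2 hxK
  refine ⟨A, fun η hη => ?_⟩
  have hC : (0 : ℝ) ≤ C := C.2
  -- The sum of the five error terms in `split`: `C + 4C` from the affine approximations at `z`, 4
  -- from the differentiability of `G`, and `2‖A‖ + ‖A‖` from the terms with `A`.
  set B : ℝ := 5 * C + 4 + 3 * ‖A‖ with hB
  have hBpos : 0 < B := by have := norm_nonneg A; positivity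
  obtain ⟨s, hs0, hs1, hsB⟩ : ∃ s : ℝ, 0 < s ∧ s < 1 ∧ B * s ≤ η := by
    refine ⟨min (1 / 2) (η / B), by positivity, by
      exact lt_of_le_of_lt (min_le_left _ _) (by norm_num), ?_⟩
    calc B * min (1 / 2) (η / B) ≤ B * (η / B) := by gcongr; exact min_le_right _ _
      _ = η := by field_simp
  obtain ⟨k, hk⟩ := exists_nat_one_div_lt (show (0 : ℝ) < s ^ 2 by positivity)
  set ε : ℝ := 1 / ((k : ℝ) + 1) with hε
  have hε0 : 0 < ε := by positivity
  have hεs : ε ≤ s ^ 2 := hk.le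
  have hs2 : s ^ 2 ≤ s := by nlinarith
  have hd := hx1 hxK k
  have hA' := hA.isLittleO.def hε0
  rw [eventually_nhdsWithin_iff, Metric.eventually_nhds_iff] at hA'
  rw [Metric.eventually_nhds_iff] at hd
  obtain ⟨ρ1, hρ1, hd⟩ := hd
  obtain ⟨ρ2, hρ2, hA'⟩ := hA'
  set g : ℝ × ℝ → ℝ := fun y => f (x + y) - f x - dot (G x) y - 1 / 2 * dot (A y) y with hg
  have hAy : ∀ y z, |dot (A y) z| ≤ 2 * ‖A‖ * (‖y‖ * ‖z‖) := fun y z => by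
    calc |dot (A y) z| ≤ 2 * (‖A y‖ * ‖z‖) := abs_dot_le _ _
      _ ≤ 2 * (‖A‖ * ‖y‖ * ‖z‖) := by gcongr; exact A.le_opNorm y
      _ = _ := by ring
  rw [Metric.eventually_nhds_iff]
  refine ⟨min ρ1 (ρ2 / 2), by positivity, fun y hy => ?_⟩
  rw [dist_zero_right] at hy
  have hθ : (1 - (1 - s)) = s := by ring
  -- An increment over the short radial segment from `(1 - s) y` to `y` is `O(s²‖y‖²)`; summing the
  -- scales geometrically loses one factor `s`. Only radial increments enter, so `A` need not be
  -- symmetric.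
  have main := abs_le_of_scaling (g := g) (θ := 1 - s) (A := C + ‖A‖) (B := B)
    (ρ := min ρ1 (ρ2 / 2)) (by linarith) (by linarith) hBpos.le ?_ ?_ y hy
  · rw [hθ] at main
    exact main.trans (mul_le_mul_of_nonneg_right hsB (sq_nonneg _))
  · intro y _
    have h1 := h x hxK (x + y)
    have h2 := hAy y y
    rw [show x + y - x = y by abel] at h1
    simp only [hg]
    rw [abs_le] at *
    constructor <;> nlinarith [h1.1, h1.2, h2.1, h2.2]
  · intro y hy
    rw [hθ]
    rcases eq_or_ne y 0 with rfl | hy0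
    · simp
    obtain ⟨z, hzK, hz⟩ := hd (by rw [dist_zero_right]; exact hy.trans_le (min_le_left _ _)) hy0
    have hny := norm_nonneg y
    have hε1 : ε ≤ 1 := by nlinarith
    have hzx : ‖z - x‖ ≤ 2 * ‖y‖ := by
      have : z - x = (z - (x + y)) + y := by abel
      rw [this]
      refine (norm_add_le _ _).trans ?_
      nlinarith
    have hzA := hA' (y := z) (by
      rw [dist_eq_norm]
      have := hy.trans_le (min_le_right _ _)
      linarith) hzK
    have E1 := h z hzK (x + y)
    have E2 := h z hzK (x + (1 - s) • y)
    have n1 : ‖x + y - z‖ ≤ s ^ 2 * ‖y‖ := by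
      rw [norm_sub_rev]; exact hz.trans (by gcongr)
    have n2 : ‖x + (1 - s) • y - z‖ ≤ 2 * s * ‖y‖ := by
      have : x + (1 - s) • y - z = (x + y - z) - s • y := by rw [sub_smul, one_smul]; abel
      rw [this]
      refine (norm_sub_le _ _).trans ?_
      rw [norm_smul, Real.norm_eq_abs, abs_of_pos hs0]
      nlinarith
    have n1' : ‖x + y - z‖ ^ 2 ≤ s ^ 2 * ‖y‖ ^ 2 := by
      calc ‖x + y - z‖ ^ 2 ≤ (s * ‖y‖) ^ 2 := by
            refine pow_le_pow_left₀ (norm_nonneg _) (n1.trans ?_) 2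
            gcongr
        _ = _ := by ring
    have n2' : ‖x + (1 - s) • y - z‖ ^ 2 ≤ 4 * s ^ 2 * ‖y‖ ^ 2 := by
      calc _ ≤ (2 * s * ‖y‖) ^ 2 := pow_le_pow_left₀ (norm_nonneg _) n2 2
        _ = _ := by ring
    have E1' := E1.trans (mul_le_mul_of_nonneg_left n1' hC)
    have E2' := E2.trans (mul_le_mul_of_nonneg_left n2' hC)
    set e : ℝ × ℝ := G z - G x - A (z - x) with he
    have E3 : |dot e y| ≤ 4 * s ^ 2 * ‖y‖ ^ 2 := by
      calc |dot e y| ≤ 2 * (‖e‖ * ‖y‖) := abs_dot_le _ _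
        _ ≤ 2 * ((s ^ 2 * (2 * ‖y‖)) * ‖y‖) := by
            gcongr
            exact hzA.trans (by gcongr)
        _ = _ := by ring
    have E4 : |dot (A (z - (x + y))) y| ≤ 2 * ‖A‖ * s ^ 2 * ‖y‖ ^ 2 := by
      calc _ ≤ 2 * ‖A‖ * (‖z - (x + y)‖ * ‖y‖) := hAy _ _
        _ ≤ 2 * ‖A‖ * ((s ^ 2 * ‖y‖) * ‖y‖) := by gcongr; exact hz.trans (by gcongr)
        _ = _ := by ring
    have E5 := hAy y y
    -- Both values of `f` are compared with the affine approximation at the nearby point `z` of `K`,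
    -- whose slope is then replaced by `G x + A (z - x)`.
    have split : g y - g ((1 - s) • y)
        = (f (x + y) - f z - dot (G z) (x + y - z))
          - (f (x + (1 - s) • y) - f z - dot (G z) (x + (1 - s) • y - z))
          + s * dot e y + s * dot (A (z - (x + y))) y + s ^ 2 / 2 * dot (A y) y := by
      simp only [hg, he, dot_sub_left, dot_add_right, dot_sub_right, dot_smul_right, map_sub,
        map_add, dot_add_left, map_smul, dot_smul_left]
      ring
    rw [split]
    have hsy : 0 ≤ s ^ 2 * ‖y‖ ^ 2 := by positivity
    have E3' : |s * dot e y| ≤ 4 * (s ^ 2 * ‖y‖ ^ 2) := by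
      rw [abs_mul, abs_of_pos hs0]
      exact (mul_le_of_le_one_left (abs_nonneg _) hs1.le).trans (E3.trans_eq (by ring))
    have E4' : |s * dot (A (z - (x + y))) y| ≤ 2 * ‖A‖ * (s ^ 2 * ‖y‖ ^ 2) := by
      rw [abs_mul, abs_of_pos hs0]
      exact (mul_le_of_le_one_left (abs_nonneg _) hs1.le).trans (E4.trans_eq (by ring))
    have E5' : |s ^ 2 / 2 * dot (A y) y| ≤ ‖A‖ * (s ^ 2 * ‖y‖ ^ 2) := by
      rw [abs_mul, abs_of_pos (by positivity : 0 < s ^ 2 / 2)]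
      exact (mul_le_mul_of_nonneg_left E5 (by positivity : 0 ≤ s ^ 2 / 2)).trans_eq (by ring)
    have hBe : B * s ^ 2 * ‖y‖ ^ 2 = C * (s ^ 2 * ‖y‖ ^ 2) + C * (4 * s ^ 2 * ‖y‖ ^ 2)
      + 4 * (s ^ 2 * ‖y‖ ^ 2) + 2 * ‖A‖ * (s ^ 2 * ‖y‖ ^ 2) + ‖A‖ * (s ^ 2 * ‖y‖ ^ 2) := by
      rw [hB]; ring
    rw [hBe]
    rw [abs_le] at *
    constructor <;> linarith [E1'.1, E1'.2, E2'.1, E2'.2, E3'.1, E3'.2, E4'.1, E4'.2, E5'.1, E5'.2]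

/-! ### Doubling of variables and the jets at a perturbed maximum -/

lemma exists_attained_sup {ι : Type*} [TopologicalSpace ι] {D : Set ι} (hD : IsCompact D)
    (hne : D.Nonempty) {f : ι → ℝ × ℝ → ℝ} (hf : ∀ z, ContinuousOn (fun ζ => f ζ z) D) :
    ∃ U : ℝ × ℝ → ℝ, (∀ z, ∀ ζ ∈ D, f ζ z ≤ U z) ∧ ∀ z, ∃ ζ ∈ D, U z = f ζ z := by
  choose ζ hζ hmax using fun z => hD.exists_isMaxOn hne (hf z)
  exact ⟨fun z => f (ζ z) z, fun z ξ hξ => hmax z hξ, fun z => ⟨ζ z, hζ z, rfl⟩⟩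

/-- The functional maximized when the variables are doubled, with a linear perturbation `q`. -/
def doubling (u w : ℝ × ℝ → ℝ) (Ψ : ℝ × ℝ → ℝ × ℝ) (δ : ℝ) (q ζ₁ ζ₂ z : ℝ × ℝ) : ℝ :=
  u ζ₁ - w ζ₂ - dot (z - Ψ ζ₁) (z - Ψ ζ₁) / (2 * δ) - dot (z - Ψ ζ₂) (z - Ψ ζ₂) / (2 * δ)
    - dot q z

lemma dot_self_nonneg (a : ℝ × ℝ) : 0 ≤ dot a a := by
  simp only [dot]; nlinarith [mul_self_nonneg a.1, mul_self_nonneg a.2]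

lemma dot_self_le (a : ℝ × ℝ) : dot a a ≤ 2 * ‖a‖ ^ 2 := by
  have := (abs_le.1 (abs_dot_le a a)).2
  nlinarith

lemma continuousOn_dot {ι : Type*} [TopologicalSpace ι] {S : Set ι} {f g : ι → ℝ × ℝ}
    (hf : ContinuousOn f S) (hg : ContinuousOn g S) : ContinuousOn (fun x => dot (f x) (g x)) S :=
  (hf.fst.mul hg.fst).add (hf.snd.mul hg.snd)

lemma continuousOn_doubling {D : Set (ℝ × ℝ)} {u w : ℝ × ℝ → ℝ} {Ψ : ℝ × ℝ → ℝ × ℝ}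
    (hu : ContinuousOn u D) (hw : ContinuousOn w D) (hΨ : ContinuousOn Ψ D) (δ : ℝ) (q : ℝ × ℝ)
    {z : (ℝ × ℝ) × (ℝ × ℝ) → ℝ × ℝ} (hz : ContinuousOn z (D ×ˢ D)) :
    ContinuousOn (fun p => doubling u w Ψ δ q p.1 p.2 (z p)) (D ×ˢ D) := by
  have h1 : ContinuousOn (fun p : (ℝ × ℝ) × (ℝ × ℝ) => Ψ p.1) (D ×ˢ D) :=
    hΨ.comp continuousOn_fst fun p hp => hp.1
  have h2 : ContinuousOn (fun p : (ℝ × ℝ) × (ℝ × ℝ) => Ψ p.2) (D ×ˢ D) :=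
    hΨ.comp continuousOn_snd fun p hp => hp.2
  have h3 : ContinuousOn (fun p : (ℝ × ℝ) × (ℝ × ℝ) => u p.1) (D ×ˢ D) :=
    hu.comp continuousOn_fst fun p hp => hp.1
  have h4 : ContinuousOn (fun p : (ℝ × ℝ) × (ℝ × ℝ) => w p.2) (D ×ˢ D) :=
    hw.comp continuousOn_snd fun p hp => hp.2
  exact (((h3.sub h4).sub ((continuousOn_dot (hz.sub h1) (hz.sub h1)).div_const _)).sub
    ((continuousOn_dot (hz.sub h2) (hz.sub h2)).div_const _)).sub
    (continuousOn_dot continuousOn_const hz)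

/-- For fixed `ζ₁, ζ₂` the functional is a concave quadratic in `z`, maximal at `(Ψ ζ₁ + Ψ ζ₂ - δ
q)/2`. Inserting this point reduces the unbounded variable to compactness of `D × D`. -/
lemma exists_doubling_max {D : Set (ℝ × ℝ)} (hD : IsCompact D) (hne : D.Nonempty)
    {u w : ℝ × ℝ → ℝ} {Ψ : ℝ × ℝ → ℝ × ℝ} (hu : ContinuousOn u D) (hw : ContinuousOn w D)
    (hΨ : ContinuousOn Ψ D) {δ : ℝ} (hδ : 0 < δ) (q : ℝ × ℝ) :
    ∃ ζ₁ ∈ D, ∃ ζ₂ ∈ D, ∃ z : ℝ × ℝ, (2 : ℝ) • z + δ • q = Ψ ζ₁ + Ψ ζ₂ ∧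
      ∀ ξ₁ ∈ D, ∀ ξ₂ ∈ D, ∀ y,
        doubling u w Ψ δ q ξ₁ ξ₂ y ≤ doubling u w Ψ δ q ζ₁ ζ₂ z := by
  set zo : (ℝ × ℝ) × (ℝ × ℝ) → ℝ × ℝ := fun p => (1 / 2 : ℝ) • (Ψ p.1 + Ψ p.2 - δ • q) with hzo
  have h1 : ContinuousOn (fun p : (ℝ × ℝ) × (ℝ × ℝ) => Ψ p.1) (D ×ˢ D) :=
    hΨ.comp continuousOn_fst fun p hp => hp.1
  have h2 : ContinuousOn (fun p : (ℝ × ℝ) × (ℝ × ℝ) => Ψ p.2) (D ×ˢ D) :=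
    hΨ.comp continuousOn_snd fun p hp => hp.2
  have hz : ContinuousOn zo (D ×ˢ D) := by
    have : ContinuousOn (fun p : (ℝ × ℝ) × (ℝ × ℝ) => Ψ p.1 + Ψ p.2 - δ • q) (D ×ˢ D) :=
      (h1.add h2).sub continuousOn_const
    exact this.const_smul (1 / 2 : ℝ)
  have hcont := continuousOn_doubling hu hw hΨ δ q hz
  obtain ⟨p, hp, hmax⟩ := (hD.prod hD).exists_isMaxOn (hne.prod hne) hcont
  refine ⟨p.1, hp.1, p.2, hp.2, zo p, ?_, fun ξ₁ hξ₁ ξ₂ hξ₂ y => ?_⟩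
  · simp only [hzo, smul_smul]; norm_num
  · refine le_trans ?_ (hmax (mk_mem_prod hξ₁ hξ₂))
    have : doubling u w Ψ δ q ξ₁ ξ₂ y = doubling u w Ψ δ q ξ₁ ξ₂ (zo (ξ₁, ξ₂))
        - dot (y - zo (ξ₁, ξ₂)) (y - zo (ξ₁, ξ₂)) / δ := by
      simp only [doubling, dot, hzo, Prod.fst_sub, Prod.snd_sub, Prod.smul_fst, Prod.smul_snd,
        Prod.fst_add, Prod.snd_add, smul_eq_mul]
      field_simp
      ring
    rw [this]
    have := div_nonneg (dot_self_nonneg (y - zo (ξ₁, ξ₂))) hδ.le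
    simp only
    linarith

/-- A second order expansion in the plane, with the mixed terms absorbed. -/
lemma second_order_bound {A : ℝ × ℝ →L[ℝ] ℝ × ℝ} {η : ℝ} (hη : 0 < η) :
    ∃ B, ∀ (h : ℝ × ℝ) (e : ℝ), |e - 1 / 2 * dot (A h) h| ≤ η / 2 * ‖h‖ ^ 2 →
      |e - 1 / 2 * (A (0, 1)).2 * h.2 ^ 2| ≤ η * h.2 ^ 2 + B * h.1 ^ 2 := by
  set s := (A (1, 0)).2 + (A (0, 1)).1 with hs
  refine ⟨η / 2 + |(A (1, 0)).1| + s ^ 2 / η, fun h e he => ?_⟩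
  have hA : A h = h.1 • A (1, 0) + h.2 • A (0, 1) := by
    rw [← map_smul, ← map_smul, ← map_add]; congr 1; ext <;> simp
  have hd : dot (A h) h = (A (1, 0)).1 * h.1 ^ 2 + s * (h.1 * h.2) + (A (0, 1)).2 * h.2 ^ 2 := by
    rw [hA]; simp [dot, hs]; ring
  have hn : ‖h‖ ^ 2 ≤ h.1 ^ 2 + h.2 ^ 2 := by
    rw [Prod.norm_def]
    rcases max_cases ‖h.1‖ ‖h.2‖ with ⟨h1, _⟩ | ⟨h1, _⟩ <;> rw [h1, Real.norm_eq_abs, sq_abs] <;>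
      nlinarith [sq_nonneg h.1, sq_nonneg h.2]
  -- Young's inequality: the large coefficient falls on the time increment, which is harmless
  -- because the equation is of first order in time.
  have hm : |s * (h.1 * h.2)| ≤ η * h.2 ^ 2 + s ^ 2 / η * h.1 ^ 2 := by
    have : s ^ 2 / η * h.1 ^ 2 = η * (s * h.1 / η) ^ 2 := by field_simp
    rw [this]
    have e2 : s * (h.1 * h.2) = η * ((s * h.1 / η) * h.2) := by field_simp
    rw [e2, abs_le]
    constructor <;>
    nlinarith [mul_nonneg hη.le (sq_nonneg (s * h.1 / η + h.2)),
      mul_nonneg hη.le (sq_nonneg (s * h.1 / η - h.2)), mul_nonneg hη.le (sq_nonneg h.2),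
      mul_nonneg hη.le (sq_nonneg (s * h.1 / η))]
  have ha : |(A (1, 0)).1 * h.1 ^ 2| ≤ |(A (1, 0)).1| * h.1 ^ 2 := by
    rw [abs_mul, abs_of_nonneg (sq_nonneg h.1)]
  have hs0 : 0 ≤ s ^ 2 / η * h.1 ^ 2 := by positivity
  have ha0 : 0 ≤ |(A (1, 0)).1| * h.1 ^ 2 := by positivity
  have he' := he.trans (mul_le_mul_of_nonneg_left hn (by positivity : 0 ≤ η / 2))
  rw [hd] at he'
  rw [abs_le] at *
  constructor <;> nlinarith [he'.1, he'.2, hm.1, hm.2, ha.1, ha.2]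

/-- **Jensen's lemma, combined with the theorem on sums.** For arbitrarily small perturbations `q`
the doubled functional has a maximum at which `u` has a second order superjet `(G, X)` and `w` a
second order subjet `(G - q, X)`, in the coordinates given by `Ψ`. -/
theorem exists_doubling_jets {D : Set (ℝ × ℝ)} (hD : IsCompact D) (hne : D.Nonempty)
    {u w : ℝ × ℝ → ℝ} {Ψ : ℝ × ℝ → ℝ × ℝ} (hu : ContinuousOn u D) (hw : ContinuousOn w D)
    (hΨ : ContinuousOn Ψ D) {δ r : ℝ} (hδ : 0 < δ) (hr : 0 < r) :
    ∃ ζ₁ ∈ D, ∃ ζ₂ ∈ D, ∃ (z q G : ℝ × ℝ) (X : ℝ), ‖q‖ < r ∧ Ψ ζ₁ - z = δ • G ∧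
      z - Ψ ζ₂ = δ • (G - q) ∧ |X| ≤ 2 / δ ∧
      (∀ ξ₁ ∈ D, ∀ ξ₂ ∈ D, ∀ y,
        doubling u w Ψ δ q ξ₁ ξ₂ y ≤ doubling u w Ψ δ q ζ₁ ζ₂ z) ∧
      ∀ η > 0, ∃ B, ∀ᶠ h in 𝓝 (0 : ℝ × ℝ),
        (∀ ξ ∈ D, Ψ ξ = Ψ ζ₁ + h →
          u ξ ≤ u ζ₁ + dot G h + (1 / 2 * X + η) * h.2 ^ 2 + B * h.1 ^ 2) ∧
        (∀ ξ ∈ D, Ψ ξ = Ψ ζ₂ + h →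
          w ζ₂ + dot (G - q) h + (1 / 2 * X - η) * h.2 ^ 2 - B * h.1 ^ 2 ≤ w ξ) := by
  choose ζ₁ hζ₁ ζ₂ hζ₂ z hz hmax using fun q => exists_doubling_max hD hne hu hw hΨ hδ q
  have hδ2 : (0 : ℝ) < 2 * δ := by positivity
  obtain ⟨U, hU, hU'⟩ := exists_attained_sup hD hne
    (f := fun ζ z => u ζ - dot (z - Ψ ζ) (z - Ψ ζ) / (2 * δ))
    (fun z => by unfold dot; fun_prop)
  obtain ⟨Φ, hΦ, hΦ'⟩ := exists_attained_sup (hD.prod hD) (hne.prod hne)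
    (f := fun (p : (ℝ × ℝ) × (ℝ × ℝ)) z => doubling u w Ψ δ 0 p.1 p.2 z)
    (fun z => continuousOn_doubling hu hw hΨ δ 0 continuousOn_const)
  have hdq : ∀ q ξ₁ ξ₂ y, doubling u w Ψ δ 0 ξ₁ ξ₂ y = doubling u w Ψ δ q ξ₁ ξ₂ y + dot q y := by
    intro q ξ₁ ξ₂ y; simp [doubling, dot]
  have hΦz : ∀ q, Φ (z q) = doubling u w Ψ δ q (ζ₁ q) (ζ₂ q) (z q) + dot q (z q) := by
    intro q
    refine le_antisymm ?_ ?_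
    · obtain ⟨p, hp, h⟩ := hΦ' (z q)
      rw [h, hdq q]
      linarith [hmax q p.1 hp.1 p.2 hp.2 (z q)]
    · rw [← hdq]
      exact hΦ (z q) (ζ₁ q, ζ₂ q) ⟨hζ₁ q, hζ₂ q⟩
  have hUz : ∀ q, U (z q) = u (ζ₁ q) - dot (z q - Ψ (ζ₁ q)) (z q - Ψ (ζ₁ q)) / (2 * δ) := by
    intro q
    refine le_antisymm ?_ (hU _ _ (hζ₁ q))
    obtain ⟨ξ, hξ, h⟩ := hU' (z q)
    rw [h]
    have := hmax q ξ hξ (ζ₂ q) (hζ₂ q) (z q)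
    simp only [doubling] at this
    linarith
  have hsq : ∀ h : ℝ × ℝ, dot h h / δ ≤ 2 / δ * ‖h‖ ^ 2 := fun h => by
    rw [div_le_iff₀ hδ]
    have := dot_self_le h
    field_simp
    linarith
  -- From below, keep `ζ₁ q, ζ₂ q` as competitors: in `z` the functional is an exact concave
  -- parabola. From above, `Φ - q·y` is maximal at `z q`.
  have hΦ2 : ∀ q y, |Φ y - Φ (z q) - dot q (y - z q)| ≤ 2 / δ * ‖y - z q‖ ^ 2 := by
    intro q y
    have hnn : 0 ≤ 2 / δ * ‖y - z q‖ ^ 2 := by positivity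
    rw [abs_le]
    constructor
    · have h1 := hΦ y (ζ₁ q, ζ₂ q) ⟨hζ₁ q, hζ₂ q⟩
      have h2 : doubling u w Ψ δ 0 (ζ₁ q) (ζ₂ q) y = Φ (z q) + dot q (y - z q)
          - dot (y - z q) (y - z q) / δ := by
        rw [hΦz q]
        have e1 := congrArg Prod.fst (hz q)
        have e2 := congrArg Prod.snd (hz q)
        simp only [Prod.fst_add, Prod.snd_add, Prod.smul_fst, Prod.smul_snd, smul_eq_mul] at e1 e2
        have e1' : (Ψ (ζ₁ q)).1 = 2 * (z q).1 + δ * q.1 - (Ψ (ζ₂ q)).1 := by linarith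
        have e2' : (Ψ (ζ₁ q)).2 = 2 * (z q).2 + δ * q.2 - (Ψ (ζ₂ q)).2 := by linarith
        simp only [doubling, dot, Prod.fst_sub, Prod.snd_sub, e1', e2', Prod.fst_zero,
          Prod.snd_zero]
        field_simp
        ring
      linarith [hsq (y - z q)]
    · obtain ⟨p, hp, h⟩ := hΦ' y
      rw [h, hdq q, hΦz q, dot_sub_right]
      linarith [hmax q p.1 hp.1 p.2 hp.2 y]
  set G : ℝ × ℝ → ℝ × ℝ := fun q => (1 / δ) • (Ψ (ζ₁ q) - z q) with hG
  have hG1 : ∀ q, Ψ (ζ₁ q) - z q = δ • G q := fun q => by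
    rw [hG, smul_smul, mul_one_div_cancel hδ.ne', one_smul]
  have hG2 : ∀ q, z q - Ψ (ζ₂ q) = δ • (G q - q) := fun q => by
    rw [smul_sub, ← hG1]
    have := hz q
    rw [two_smul] at this
    linear_combination (exp := 1) this
  -- From below, keep `ζ₁ q`. From above, maximality with `ζ₂ q` kept bounds `U` by a convex
  -- parabola of slope `(z - Ψ ζ₂)/δ + q`, which equals `G`.
  have hUy : ∀ q y, |U y - U (z q) - dot (G q) (y - z q)| ≤ 1 / δ * ‖y - z q‖ ^ 2 := by
    intro q y
    have hs : dot (y - z q) (y - z q) / (2 * δ) ≤ 1 / δ * ‖y - z q‖ ^ 2 := by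
      have := hsq (y - z q)
      have e : dot (y - z q) (y - z q) / (2 * δ) = 1 / 2 * (dot (y - z q) (y - z q) / δ) := by
        field_simp
      have e' : 1 / δ * ‖y - z q‖ ^ 2 = 1 / 2 * (2 / δ * ‖y - z q‖ ^ 2) := by field_simp
      rw [e, e']; linarith
    rw [abs_le]
    constructor
    · have h1 := hU y (ζ₁ q) (hζ₁ q)
      have h2 : u (ζ₁ q) - dot (y - Ψ (ζ₁ q)) (y - Ψ (ζ₁ q)) / (2 * δ) = U (z q)
          + dot (G q) (y - z q) - dot (y - z q) (y - z q) / (2 * δ) := by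
        rw [hUz q]
        have e : Ψ (ζ₁ q) = z q + δ • G q := by rw [← hG1]; abel
        rw [e]
        simp only [dot, Prod.fst_sub, Prod.snd_sub, Prod.fst_add, Prod.snd_add, Prod.smul_fst,
          Prod.smul_snd, smul_eq_mul]
        field_simp
        ring
      linarith
    · obtain ⟨ξ, hξ, h⟩ := hU' y
      have h1 := hmax q ξ hξ (ζ₂ q) (hζ₂ q) y
      have h2 : dot (y - Ψ (ζ₂ q)) (y - Ψ (ζ₂ q)) / (2 * δ)
          = dot (z q - Ψ (ζ₂ q)) (z q - Ψ (ζ₂ q)) / (2 * δ) + dot (G q) (y - z q)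
            - dot q (y - z q) + dot (y - z q) (y - z q) / (2 * δ) := by
        have e : Ψ (ζ₂ q) = z q - δ • (G q - q) := by rw [← hG2]; abel
        rw [e]
        simp only [dot, Prod.fst_sub, Prod.snd_sub, Prod.smul_fst,
          Prod.smul_snd, smul_eq_mul]
        field_simp
        ring
      simp only [doubling] at h1
      have h3 := hUz q
      rw [dot_sub_right q] at h2
      linarith
  set C : NNReal := ⟨2 / δ, by positivity⟩ with hC
  set C' : NNReal := ⟨1 / δ, by positivity⟩ with hC'
  have hinj : Function.Injective z := fun q q' h => by
    have := norm_sub_le_of_quadratic_bound C.2 (hΦ2 q) (hΦ2 q')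
    rw [h, sub_self, norm_zero, mul_zero, norm_le_zero_iff, sub_eq_zero] at this
    exact this
  have hli : ∀ q, Function.invFun z (z q) = q := Function.leftInverse_invFun hinj
  set K : Set (ℝ × ℝ) := z '' Metric.ball 0 r with hK
  have hlip : LipschitzOnWith (6 * C) (Function.invFun z) K := by
    refine lipschitzOnWith_of_quadratic_bound (f := Φ) ?_
    rintro _ ⟨q, -, rfl⟩ y
    rw [hli]
    exact hΦ2 q y
  -- The Lipschitz left inverse maps `K` onto a ball, so `K` cannot be null. Two-dimensional
  -- Hausdorff measure makes this precise.
  have hvol : volume K ≠ 0 := by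
    intro h0
    have h1 := hlip.hausdorffMeasure_image_le (d := 2) (by norm_num)
    have h2 : Function.invFun z '' K = Metric.ball 0 r := by
      rw [hK, image_image]; simp [hli]
    rw [h2, hausdorffMeasure_prod_real, h0, mul_zero] at h1
    exact (Metric.measure_ball_pos volume (0 : ℝ × ℝ) hr).not_ge h1
  have hae := ae_second_order_expansion (f := U) (G := fun x => G (Function.invFun z x)) (K := K)
    (C := C') (by
      rintro _ ⟨q, -, rfl⟩ y
      rw [hli]
      exact hUy q y)
  obtain ⟨x, hxK, hx⟩ : ∃ x ∈ K, x ∈ K → ∃ A : ℝ × ℝ →L[ℝ] ℝ × ℝ, ∀ η > 0,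
      ∀ᶠ y in 𝓝 (0 : ℝ × ℝ), |U (x + y) - U x - dot (G (Function.invFun z x)) y
        - 1 / 2 * dot (A y) y| ≤ η * ‖y‖ ^ 2 := by
    by_contra hcon
    push Not at hcon
    apply hvol
    rw [← nonpos_iff_eq_zero]
    refine (measure_mono fun y hy => ?_).trans hae.le
    have := hcon y hy
    simp only [mem_compl_iff, mem_ofPred_eq]
    push Not
    exact this
  obtain ⟨A, hA⟩ := hx hxK
  obtain ⟨q, hq, rfl⟩ := hxK
  rw [hli] at hA
  set X := (A (0, 1)).2 with hX
  have hexp : ∀ η > 0, ∃ B, ∀ᶠ h in 𝓝 (0 : ℝ × ℝ),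
      |U (z q + h) - U (z q) - dot (G q) h - 1 / 2 * X * h.2 ^ 2| ≤ η * h.2 ^ 2 + B * h.1 ^ 2 := by
    intro η hη
    obtain ⟨B, hB⟩ := second_order_bound (A := A) hη
    exact ⟨B, (hA (η / 2) (by positivity)).mono fun h hh => hB h _ hh⟩
  refine ⟨ζ₁ q, hζ₁ q, ζ₂ q, hζ₂ q, z q, q, G q, X, by simpa using hq, hG1 q, hG2 q, ?_,
    hmax q, ?_⟩
  -- Along increments with vanishing time component the term in `B` disappears, and the expansion is
  -- compared with the two-sided bound `hUy`.
  · refine le_of_forall_pos_le_add fun η hη => ?_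
    obtain ⟨B, hB⟩ := hexp (η / 2) (by positivity)
    have ht : Tendsto (fun s : ℝ => ((0 : ℝ), s)) (𝓝[≠] 0) (𝓝 0) := by
      have : Continuous fun s : ℝ => ((0 : ℝ), s) := by fun_prop
      exact (this.tendsto 0).mono_left nhdsWithin_le_nhds
    obtain ⟨s, hs, hs0⟩ := ((ht.eventually hB).and self_mem_nhdsWithin).exists
    have hs0 : s ≠ 0 := hs0
    have h2 := hUy q (z q + (0, s))
    rw [add_sub_cancel_left] at h2
    have hn : ‖((0 : ℝ), s)‖ ^ 2 = s ^ 2 := by simp [Prod.norm_def]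
    rw [hn] at h2
    simp only at hs
    have hpos : 0 < s ^ 2 := by positivity
    have h3 : |1 / 2 * X * s ^ 2| ≤ (1 / δ + η / 2) * s ^ 2 := by
      rw [abs_le] at *
      constructor <;> nlinarith [hs.1, hs.2, h2.1, h2.2]
    rw [abs_mul, abs_of_pos hpos, abs_mul, abs_of_pos (by norm_num : (0 : ℝ) < 1 / 2)] at h3
    have h4 := le_of_mul_le_mul_right h3 hpos
    have : 2 / δ = 2 * (1 / δ) := by ring
    rw [this]; linarith
  · intro η hη
    obtain ⟨B, hB⟩ := hexp η hη
    refine ⟨B, hB.mono fun h hh => ⟨fun ξ hξ hΨξ => ?_, fun ξ hξ hΨξ => ?_⟩⟩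
    -- Shifting `z` and `Ψ ξ` by the same `h` leaves the penalty unchanged, so the expansion of `U`
    -- passes to `u`; for `w` the same shift is combined with maximality.
    · have h1 := hU (z q + h) ξ hξ
      rw [hΨξ, add_sub_add_right_eq_sub] at h1
      have h2 := hUz q
      have h3 := (abs_le.1 hh).2
      linarith
    · obtain ⟨ξ₁, hξ₁, h1⟩ := hU' (z q + h)
      have h2 := hmax q ξ₁ hξ₁ ξ hξ (z q + h)
      simp only [doubling] at h2
      rw [hΨξ, add_sub_add_right_eq_sub, dot_add_right] at h2
      have h3 := (abs_le.1 hh).1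
      have h4 := hUz q
      rw [dot_sub_left]
      linarith

/-! ### The stretched variable and the coefficients of the transformed equation -/

lemma unitBallVol_pos (n : ℕ) : 0 < unitBallVol n :=
  ENNReal.toReal_pos (Metric.measure_ball_pos volume _ one_pos).ne' measure_ball_lt_top.ne

lemma kappa_pos (n : ℕ) [NeZero n] {v : ℝ} (hv : 0 < v) : 0 < kappa n v := by
  have h1 := unitBallVol_pos n
  have h2 : (0 : ℝ) < n := Nat.cast_pos.2 (NeZero.pos n)
  unfold kappa
  positivity

lemma contDiffOn_kappa (n : ℕ) : ContDiffOn ℝ 2 (kappa n) (Ioi 0) := by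
  unfold kappa
  exact contDiffOn_const.mul (contDiffOn_id.rpow_const_of_ne fun x hx => (mem_Ioi.1 hx).ne')

/-- The derivative of the change of variables `Y` which makes the coefficient of the second order
term of the mass equation independent of `v`. -/
def stretch (n : ℕ) (m v : ℝ) : ℝ := kappa n v ^ (-2 / (m + 1))

lemma stretch_pos (n : ℕ) [NeZero n] (m : ℝ) {v : ℝ} (hv : 0 < v) : 0 < stretch n m v :=
  Real.rpow_pos_of_pos (kappa_pos n hv) _

lemma contDiffOn_stretch (n : ℕ) [NeZero n] (m : ℝ) : ContDiffOn ℝ 2 (stretch n m) (Ioi 0) :=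
  (contDiffOn_kappa n).rpow_const_of_ne fun _ hx => (kappa_pos n hx).ne'

/-- This identity dictates the exponent `-2/(m+1)`: `Y'^{m-1}` comes from differentiating the power
and `Y'²` from the second derivative, so the diffusion coefficient becomes 1. -/
lemma kappa_sq_mul_stretch (n : ℕ) [NeZero n] {m : ℝ} (hm : 0 < m) {v : ℝ} (hv : 0 < v) :
    kappa n v ^ 2 * (stretch n m v ^ (m - 1) * stretch n m v ^ 2) = 1 := by
  have hk := kappa_pos n hv
  rw [← Real.rpow_natCast (stretch n m v), ← Real.rpow_add (stretch_pos n m hv), stretch,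
    ← Real.rpow_mul hk.le, ← Real.rpow_natCast, ← Real.rpow_add hk]
  have : ((2 : ℕ) : ℝ) + -2 / (m + 1) * (m - 1 + ((2 : ℕ) : ℝ)) = 0 := by
    push_cast; field_simp; ring
  rw [this, Real.rpow_zero]

/-- The change of variables `Y`. -/
def stretched (n : ℕ) (m v : ℝ) : ℝ := ∫ x in (1 : ℝ)..v, stretch n m x

lemma hasDerivAt_stretched (n : ℕ) [NeZero n] (m : ℝ) {v : ℝ} (hv : 0 < v) :
    HasDerivAt (stretched n m) (stretch n m v) v := by
  have hc := (contDiffOn_stretch n m).continuousOn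
  refine intervalIntegral.integral_hasDerivAt_right ?_ ?_ (hc.continuousAt (Ioi_mem_nhds hv))
  · refine (hc.mono fun x hx => ?_).intervalIntegrable
    rw [uIcc, mem_Icc] at hx
    exact lt_of_lt_of_le (lt_min one_pos hv) hx.1
  · exact hc.stronglyMeasurableAtFilter isOpen_Ioi v hv

lemma deriv_stretched (n : ℕ) [NeZero n] (m : ℝ) {v : ℝ} (hv : 0 < v) :
    deriv (stretched n m) v = stretch n m v := (hasDerivAt_stretched n m hv).deriv

lemma contDiffOn_stretched (n : ℕ) [NeZero n] (m : ℝ) :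
    ContDiffOn ℝ 2 (stretched n m) (Ioi 0) := by
  rw [show (2 : WithTop ℕ∞) = 1 + 1 from rfl, contDiffOn_succ_iff_deriv_of_isOpen isOpen_Ioi]
  refine ⟨fun v hv => (hasDerivAt_stretched n m hv).differentiableAt.differentiableWithinAt,
    by simp, ?_⟩
  exact ((contDiffOn_stretch n m).of_le (by norm_num)).congr fun v hv => deriv_stretched n m hv

/-- The coefficient of `p ^ m` in the stretched variable. -/
def powCoeff (n : ℕ) (m v : ℝ) : ℝ :=
  m * kappa n v ^ 2 * stretch n m v ^ (m - 1) * deriv (stretch n m) v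

/-- The drift coefficient in the stretched variable. -/
def driftCoeff {n : ℕ} [NeZero n] (m : ℝ) (V : EuclideanSpace ℝ (Fin n) → ℝ) (v : ℝ) : ℝ :=
  kappa n v ^ 2 * stretch n m v * deriv (volPotential V) v

/-- The right-hand side of the mass equation in the stretched variable, for positive slopes `p`. -/
def rhs {n : ℕ} [NeZero n] (m : ℝ) (V : EuclideanSpace ℝ (Fin n) → ℝ) (v p X : ℝ) : ℝ :=
  m * p ^ (m - 1) * X + powCoeff n m v * p ^ m + driftCoeff m V v * p

lemma exists_lipschitz_of_contDiffOn {f : ℝ → ℝ} (hf : ContDiffOn ℝ 1 f (Ioi 0)) {α β : ℝ}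
    (hα : 0 < α) : ∃ L, LipschitzOnWith L f (Icc α β) :=
  (hf.mono fun _ hx => hα.trans_le hx.1).exists_lipschitzOnWith one_ne_zero (convex_Icc α β)
    isCompact_Icc

lemma exists_lipschitz_mul {f g : ℝ → ℝ} {α β : ℝ}
    (hf : ∃ L, LipschitzOnWith L f (Icc α β)) (hg : ∃ L, LipschitzOnWith L g (Icc α β)) :
    ∃ L, LipschitzOnWith L (fun v => f v * g v) (Icc α β) := by
  obtain ⟨L, hL⟩ := hf
  obtain ⟨L', hL'⟩ := hg
  obtain ⟨A, hA⟩ := isCompact_Icc.exists_bound_of_continuousOn hL.continuousOn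
  obtain ⟨B, hB⟩ := isCompact_Icc.exists_bound_of_continuousOn hL'.continuousOn
  refine ⟨(A.toNNReal * L' + L * B.toNNReal), LipschitzOnWith.of_dist_le_mul fun v hv w hw => ?_⟩
  have h1 := hL.dist_le_mul v hv w hw
  have h2 := hL'.dist_le_mul v hv w hw
  have hA0 := (norm_nonneg _).trans (hA v hv)
  have hB0 := (norm_nonneg _).trans (hB v hv)
  rw [Real.dist_eq] at h1 h2 ⊢
  push_cast
  rw [Real.coe_toNNReal _ hA0, Real.coe_toNNReal _ hB0]
  have e : f v * g v - f w * g w = f v * (g v - g w) + (f v - f w) * g w := by ring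
  rw [e]
  calc _ ≤ |f v * (g v - g w)| + |(f v - f w) * g w| := abs_add_le _ _
    _ = |f v| * |g v - g w| + |f v - f w| * |g w| := by rw [abs_mul, abs_mul]
    _ ≤ A * (L' * dist v w) + (L * dist v w) * B :=
        add_le_add (mul_le_mul (hA v hv) h2 (abs_nonneg _) hA0)
          (mul_le_mul h1 (hB w hw) (abs_nonneg _) (by positivity))
    _ = _ := by ring

lemma exists_lipschitz_powCoeff (n : ℕ) [NeZero n] (m : ℝ) {α β : ℝ} (hα : 0 < α) :
    ∃ L, LipschitzOnWith L (powCoeff n m) (Icc α β) := by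
  refine exists_lipschitz_of_contDiffOn ?_ hα
  have h1 : ContDiffOn ℝ 1 (kappa n) (Ioi 0) := (contDiffOn_kappa n).of_le (by norm_num)
  have h2 : ContDiffOn ℝ 1 (stretch n m) (Ioi 0) := (contDiffOn_stretch n m).of_le (by norm_num)
  have h3 : ContDiffOn ℝ 1 (deriv (stretch n m)) (Ioi 0) :=
    (contDiffOn_stretch n m).deriv_of_isOpen isOpen_Ioi (by norm_num)
  exact ((contDiffOn_const.mul (h1.pow 2)).mul
    (h2.rpow_const_of_ne fun _ hx => (stretch_pos n m hx).ne')).mul h3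

/-- By the chain rule along the first axis, `V_v` is the smooth factor `x'(v)` times a Lipschitz
gradient at the point of radius `x(v)`. Staying away from `v = 0` avoids the singularity of `x`. -/
lemma exists_lipschitz_driftCoeff {n : ℕ} [NeZero n] (m : ℝ) {R : ℝ} (hR : 0 < R)
    {V : EuclideanSpace ℝ (Fin n) → ℝ} (hV : IsW2Infty R V) {α β : ℝ} (hα : 0 < α)
    (hβ : β < ballVol n R) : ∃ L, LipschitzOnWith L (driftCoeff m V) (Icc α β) := by
  obtain ⟨hd, K, hK⟩ := hV
  have hω := unitBallVol_pos n
  have hn : (0 : ℝ) < n := Nat.cast_pos.2 (NeZero.pos n)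
  set x : ℝ → ℝ := fun v => (v / unitBallVol n) ^ (1 / (n : ℝ)) with hx
  have hxc : ContDiffOn ℝ 2 x (Ioi 0) :=
    (contDiffOn_id.div_const _).rpow_const_of_ne fun v hv => (div_pos hv hω).ne'
  have hball : ∀ v ∈ Icc α β, EuclideanSpace.single (0 : Fin n) (x v) ∈
      Metric.ball (0 : EuclideanSpace ℝ (Fin n)) R := by
    intro v hv
    have hv0 : 0 < v := hα.trans_le hv.1
    have hvR : v / unitBallVol n < R ^ n := by
      rw [div_lt_iff₀ hω]; exact hv.2.trans_lt hβ
    rw [mem_ball_zero_iff, PiLp.norm_single, Real.norm_eq_abs,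
      abs_of_nonneg (Real.rpow_nonneg (div_pos hv0 hω).le _)]
    calc x v < (R ^ n) ^ (1 / (n : ℝ)) :=
          Real.rpow_lt_rpow (div_pos hv0 hω).le hvR (by positivity)
      _ = R := by
          rw [one_div, Real.pow_rpow_inv_natCast hR.le (NeZero.ne n)]
  set g : ℝ → ℝ := fun v =>
    fderiv ℝ V (EuclideanSpace.single (0 : Fin n) (x v)) (EuclideanSpace.single (0 : Fin n) 1)
    with hg
  have hderiv : ∀ v ∈ Icc α β, deriv (volPotential V) v = deriv x v * g v := by
    intro v hv
    have hv0 : 0 < v := hα.trans_le hv.1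
    have h1 : HasDerivAt x (deriv x v) v :=
      ((hxc.differentiableOn (by norm_num)).differentiableAt (Ioi_mem_nhds hv0)).hasDerivAt
    have h2 : HasDerivAt (fun v => EuclideanSpace.single (0 : Fin n) (x v))
        (deriv x v • EuclideanSpace.single (0 : Fin n) (1 : ℝ)) v := by
      have := h1.smul_const (EuclideanSpace.single (0 : Fin n) (1 : ℝ))
      refine this.congr_of_eventuallyEq (Eventually.of_forall fun w => ?_)
      ext i
      by_cases hi : i = 0 <;> simp [hi]
    have h3 := ((hd _ (hball v hv)).differentiableAt
      (Metric.isOpen_ball.mem_nhds (hball v hv))).hasFDerivAt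
    have h4 := h3.comp_hasDerivAt v h2
    rw [map_smul, smul_eq_mul] at h4
    exact h4.deriv
  have hgL : ∃ L, LipschitzOnWith L g (Icc α β) := by
    obtain ⟨L, hL⟩ := exists_lipschitz_of_contDiffOn (β := β) (hxc.of_le (by norm_num)) hα
    refine ⟨K * L, LipschitzOnWith.of_dist_le_mul fun v hv w hw => ?_⟩
    have h1 := hK.dist_le_mul _ (hball v hv) _ (hball w hw)
    have h2 := hL.dist_le_mul v hv w hw
    rw [dist_eq_norm] at h1 ⊢
    have h3 : g v - g w = (fderiv ℝ V (EuclideanSpace.single (0 : Fin n) (x v))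
      - fderiv ℝ V (EuclideanSpace.single (0 : Fin n) (x w)))
        (EuclideanSpace.single (0 : Fin n) 1) := rfl
    rw [h3]
    refine (ContinuousLinearMap.le_opNorm _ _).trans ?_
    rw [PiLp.norm_single, norm_one, mul_one]
    refine h1.trans ?_
    rw [PiLp.dist_single_same]
    push_cast
    rw [mul_assoc]
    gcongr
  have hxL : ∃ L, LipschitzOnWith L (deriv x) (Icc α β) :=
    exists_lipschitz_of_contDiffOn (hxc.deriv_of_isOpen isOpen_Ioi (by norm_num)) hα
  have hkL : ∃ L, LipschitzOnWith L (fun v => kappa n v ^ 2 * stretch n m v) (Icc α β) :=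
    exists_lipschitz_of_contDiffOn ((((contDiffOn_kappa n).pow 2).mul
      (contDiffOn_stretch n m)).of_le (by norm_num)) hα
  obtain ⟨L, hL⟩ := exists_lipschitz_mul hkL (exists_lipschitz_mul hxL hgL)
  refine ⟨L, fun v hv w hw => ?_⟩
  simp only [driftCoeff, hderiv v hv, hderiv w hw]
  exact hL hv hw

/-! ### Viscosity inequalities for parabolas of positive slope -/

/-- The test function `f(t) + p (Y(v) - Y(v₀)) + X/2 (Y(v) - Y(v₀))²`. -/
def jetTest (n : ℕ) (m v₀ p X : ℝ) (f : ℝ → ℝ) (t v : ℝ) : ℝ :=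
  f t + (p * (stretched n m v - stretched n m v₀)
    + 1 / 2 * X * (stretched n m v - stretched n m v₀) ^ 2)

lemma hasDerivAt_jetTest (n : ℕ) [NeZero n] (m v₀ p X : ℝ) (f : ℝ → ℝ) (t : ℝ) {v : ℝ}
    (hv : 0 < v) : HasDerivAt (jetTest n m v₀ p X f t)
      (stretch n m v * (p + X * (stretched n m v - stretched n m v₀))) v := by
  have h := (hasDerivAt_stretched n m hv).sub_const (stretched n m v₀)
  have := ((h.const_mul p).add ((h.pow 2).const_mul (1 / 2 * X))).const_add (f t)
  refine this.congr_deriv ?_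
  simp; ring

/-- Positivity near `v₀` serves twice: it makes the test function admissible, and it turns the
signed power into a smooth ordinary power. -/
lemma eventually_slope_pos (n : ℕ) [NeZero n] (m : ℝ) {v₀ p : ℝ} (X : ℝ) (hv₀ : 0 < v₀)
    (hp : 0 < p) : ∀ᶠ v in 𝓝 v₀,
      0 < v ∧ 0 < stretch n m v * (p + X * (stretched n m v - stretched n m v₀)) := by
  have hY : ContinuousAt (stretched n m) v₀ := (hasDerivAt_stretched n m hv₀).continuousAt
  have hc : ContinuousAt (fun v => p + X * (stretched n m v - stretched n m v₀)) v₀ :=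
    continuousAt_const.add (continuousAt_const.mul (hY.sub continuousAt_const))
  have h2 : ∀ᶠ v in 𝓝 v₀, 0 < p + X * (stretched n m v - stretched n m v₀) :=
    hc.eventually (lt_mem_nhds (by simpa using hp))
  filter_upwards [h2, lt_mem_nhds hv₀] with v h2 h3
  exact ⟨h3, mul_pos (stretch_pos n m h3) h2⟩

/-- Small boxes around `(t₀, v₀)` make `jetTest` an admissible test function. -/
lemma eventually_isTestFunction (n : ℕ) [NeZero n] (m : ℝ) {R t₀ v₀ p : ℝ} (X : ℝ) {f : ℝ → ℝ}
    (hf : ContDiff ℝ 2 f) (ht₀ : 0 < t₀) (hv₀ : v₀ ∈ Ioo 0 (ballVol n R)) (hp : 0 < p) :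
    ∀ᶠ ε in 𝓝[>] (0 : ℝ), IsTestFunction n R t₀ v₀ ε (jetTest n m v₀ p X f) := by
  obtain ⟨ρ, hρ, hslope⟩ := Metric.eventually_nhds_iff.1 (eventually_slope_pos n m X hv₀.1 hp)
  have hpos : 0 < min (min ρ t₀) (min v₀ (ballVol n R - v₀)) :=
    lt_min (lt_min hρ ht₀) (lt_min hv₀.1 (sub_pos.2 hv₀.2))
  filter_upwards [Ioo_mem_nhdsGT hpos] with ε hε
  obtain ⟨hε0, hε⟩ := hε
  simp only [lt_min_iff] at hε
  obtain ⟨⟨h1, h2⟩, h3, h4⟩ := hε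
  have hsub : box t₀ v₀ ε ⊆ Ioi 0 ×ˢ Ioo 0 (ballVol n R) := by
    rintro ⟨t, v⟩ ⟨⟨a, b⟩, c, d⟩
    simp only at a b c d
    exact ⟨mem_Ioi.2 (by simp only; linarith), by simp only; linarith, by simp only; linarith⟩
  refine ⟨hε0, hsub, ?_, fun v hv _ => ?_⟩
  · have hY : ContDiffOn ℝ 2 (fun q : ℝ × ℝ => stretched n m q.2 - stretched n m v₀)
        (box t₀ v₀ ε) :=
      ((contDiffOn_stretched n m).comp contDiffOn_snd fun q hq => (hsub hq).2.1).sub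
        contDiffOn_const
    exact (hf.comp_contDiffOn contDiffOn_fst).add
      ((contDiffOn_const.mul hY).add (contDiffOn_const.mul (hY.pow 2)))
  · have := hslope (y := v) (by
      rw [Real.dist_eq, abs_lt]; constructor <;> linarith [hv.1, hv.2])
    rw [(hasDerivAt_jetTest n m v₀ p X f t₀ this.1).deriv]
    exact this.2.ne'

lemma signedPow_of_pos (m : ℝ) {s : ℝ} (hs : 0 < s) : signedPow m s = s ^ m := by
  rw [signedPow, abs_of_pos hs, Real.rpow_sub_one hs.ne']
  field_simp

/-- The residual of `jetTest` has a limit, given by the equation in the stretched variable. -/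
lemma tendsto_massResidual_jetTest {n : ℕ} [NeZero n] {m : ℝ} (hm : 0 < m)
    (V : EuclideanSpace ℝ (Fin n) → ℝ) {t₀ v₀ p : ℝ} (X : ℝ) {f : ℝ → ℝ}
    (hv₀ : 0 < v₀) (hp : 0 < p) :
    Tendsto (massResidual m V (jetTest n m v₀ p X f) t₀ v₀) (𝓝[≠] v₀)
      (𝓝 (deriv f t₀ - rhs m V v₀ p X)) := by
  set D : ℝ → ℝ := fun v => stretch n m v * (p + X * (stretched n m v - stretched n m v₀)) with hD
  set D' : ℝ → ℝ := fun v => deriv (stretch n m) v *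
    (p + X * (stretched n m v - stretched n m v₀)) + stretch n m v * (X * stretch n m v) with hD'
  have hs := eventually_slope_pos n m X hv₀ hp
  have hDd : ∀ v, 0 < v → HasDerivAt D (D' v) v := fun v hv => by
    have h1 : HasDerivAt (stretch n m) (deriv (stretch n m) v) v :=
      (((contDiffOn_stretch n m).differentiableOn (by norm_num)).differentiableAt
        (Ioi_mem_nhds hv)).hasDerivAt
    have h2 := (((hasDerivAt_stretched n m hv).sub_const (stretched n m v₀)).const_mul X).const_add p
    exact h1.mul h2
  have hev : ∀ᶠ v in 𝓝 v₀, deriv (fun w => signedPow m (deriv (jetTest n m v₀ p X f t₀) w)) v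
      = D' v * m * D v ^ (m - 1) := by
    filter_upwards [hs.eventually_nhds] with v hv
    have e : (fun w => signedPow m (deriv (jetTest n m v₀ p X f t₀) w)) =ᶠ[𝓝 v]
        fun w => D w ^ m := by
      filter_upwards [hv] with w hw
      rw [(hasDerivAt_jetTest n m v₀ p X f t₀ hw.1).deriv, signedPow_of_pos m hw.2]
    rw [e.deriv_eq]
    exact ((hDd v hv.self_of_nhds.1).rpow_const (Or.inl hv.self_of_nhds.2.ne')).deriv
  have hcY : ContinuousAt (stretched n m) v₀ := (hasDerivAt_stretched n m hv₀).continuousAt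
  have hch : ContinuousAt (stretch n m) v₀ :=
    (contDiffOn_stretch n m).continuousOn.continuousAt (Ioi_mem_nhds hv₀)
  have hch' : ContinuousAt (deriv (stretch n m)) v₀ :=
    ((contDiffOn_stretch n m).continuousOn_deriv_of_isOpen isOpen_Ioi
      (by norm_num)).continuousAt (Ioi_mem_nhds hv₀)
  have hc1 : ContinuousAt (fun v => p + X * (stretched n m v - stretched n m v₀)) v₀ :=
    continuousAt_const.add (continuousAt_const.mul (hcY.sub continuousAt_const))
  have hcD' : ContinuousAt D' v₀ :=
    (hch'.mul hc1).add (hch.mul (continuousAt_const.mul hch))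
  have hD0 : D v₀ = stretch n m v₀ * p := by simp [hD]
  have hcD : ContinuousAt (fun v => D v ^ (m - 1)) v₀ :=
    (hDd v₀ hv₀).continuousAt.rpow_const (Or.inl (hs.self_of_nhds.2.ne'))
  have hlim : Tendsto (fun v => D' v * m * D v ^ (m - 1)) (𝓝[≠] v₀)
      (𝓝 (D' v₀ * m * D v₀ ^ (m - 1))) :=
    ((hcD'.mul continuousAt_const).mul hcD).tendsto.mono_left nhdsWithin_le_nhds
  have hlim' := hlim.congr' ((hev.filter_mono nhdsWithin_le_nhds).mono fun v hv => hv.symm)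
  have ht : deriv (fun t => jetTest n m v₀ p X f t v₀) t₀ = deriv f t₀ := by
    simp [jetTest]
  have hfin := ((hlim'.add_const (deriv (jetTest n m v₀ p X f t₀) v₀
    * deriv (volPotential V) v₀)).const_mul (kappa n v₀ ^ 2)).const_sub
      (deriv (fun t => jetTest n m v₀ p X f t v₀) t₀)
  have hval : deriv f t₀ - rhs m V v₀ p X = deriv (fun t => jetTest n m v₀ p X f t v₀) t₀
      - kappa n v₀ ^ 2 * (D' v₀ * m * D v₀ ^ (m - 1) + deriv (jetTest n m v₀ p X f t₀) v₀
        * deriv (volPotential V) v₀) := by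
    rw [ht, (hasDerivAt_jetTest n m v₀ p X f t₀ hv₀).deriv, hD0,
      Real.mul_rpow (stretch_pos n m hv₀).le hp.le]
    have hk := kappa_sq_mul_stretch n hm hv₀
    have hpm : p ^ m = p ^ (m - 1) * p := by
      rw [Real.rpow_sub_one hp.ne']; field_simp
    simp only [rhs, powCoeff, driftCoeff, hD', sub_self, mul_zero, add_zero, hpm]
    linear_combination (m * p ^ (m - 1) * X) * hk
  rw [hval]
  exact hfin

/-- A subsolution satisfies the equation on its second order superjets of positive slope. -/
lemma IsViscositySubsolution.le_rhs {n : ℕ} [NeZero n] {m R : ℝ} (hm : 0 < m)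
    {V : EuclideanSpace ℝ (Fin n) → ℝ} {M : ℝ → ℝ → ℝ} (hM : IsViscositySubsolution m R V M)
    {t₀ v₀ p X : ℝ} {f : ℝ → ℝ} (hf : ContDiff ℝ 2 f) (ht₀ : 0 < t₀)
    (hv₀ : v₀ ∈ Ioo 0 (ballVol n R)) (hp : 0 < p) (h0 : M t₀ v₀ = f t₀)
    (hle : ∀ᶠ q in 𝓝 (t₀, v₀), M q.1 q.2 ≤ jetTest n m v₀ p X f q.1 q.2) :
    deriv f t₀ ≤ rhs m V v₀ p X := by
  obtain ⟨ρ, hρ, hle⟩ := Metric.eventually_nhds_iff.1 hle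
  obtain ⟨ε, htest, hε⟩ := ((eventually_isTestFunction n m X hf ht₀ hv₀ hp).and
    (Ioo_mem_nhdsGT hρ)).exists
  have h := hM t₀ v₀ ε _ htest (fun q hq => hle (by
    rw [Prod.dist_eq, max_lt_iff, Real.dist_eq, Real.dist_eq, abs_lt, abs_lt]
    have h1 := hq.1.1
    have h2 := hq.1.2
    have h3 := hq.2.1
    have h4 := hq.2.2
    have := hε.2
    refine ⟨⟨?_, ?_⟩, ?_, ?_⟩ <;> simp only <;> linarith)) (by simp [jetTest, h0])
  have hlim := (continuous_coe_real_ereal.tendsto _).comp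
    (tendsto_massResidual_jetTest hm V X (t₀ := t₀) (f := f) hv₀.1 hp)
  -- The residual converges, so the lower limit in the definition is a genuine limit.
  have := hlim.liminf_eq
  simp only [Function.comp_def] at this
  rw [this] at h
  have h' := EReal.coe_le_coe_iff.1 (h.trans_eq EReal.coe_zero.symm)
  linarith

/-- A supersolution satisfies the equation on its second order subjets of positive slope. -/
lemma IsViscositySupersolution.rhs_le {n : ℕ} [NeZero n] {m R : ℝ} (hm : 0 < m)
    {V : EuclideanSpace ℝ (Fin n) → ℝ} {M : ℝ → ℝ → ℝ} (hM : IsViscositySupersolution m R V M)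
    {t₀ v₀ p X : ℝ} {f : ℝ → ℝ} (hf : ContDiff ℝ 2 f) (ht₀ : 0 < t₀)
    (hv₀ : v₀ ∈ Ioo 0 (ballVol n R)) (hp : 0 < p) (h0 : M t₀ v₀ = f t₀)
    (hle : ∀ᶠ q in 𝓝 (t₀, v₀), jetTest n m v₀ p X f q.1 q.2 ≤ M q.1 q.2) :
    rhs m V v₀ p X ≤ deriv f t₀ := by
  obtain ⟨ρ, hρ, hle⟩ := Metric.eventually_nhds_iff.1 hle
  obtain ⟨ε, htest, hε⟩ := ((eventually_isTestFunction n m X hf ht₀ hv₀ hp).and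
    (Ioo_mem_nhdsGT hρ)).exists
  have h := hM t₀ v₀ ε _ htest (fun q hq => hle (by
    rw [Prod.dist_eq, max_lt_iff, Real.dist_eq, Real.dist_eq, abs_lt, abs_lt]
    have h1 := hq.1.1
    have h2 := hq.1.2
    have h3 := hq.2.1
    have h4 := hq.2.2
    have := hε.2
    refine ⟨⟨?_, ?_⟩, ?_, ?_⟩ <;> simp only <;> linarith)) (by simp [jetTest, h0])
  have hlim := (continuous_coe_real_ereal.tendsto _).comp
    (tendsto_massResidual_jetTest hm V X (t₀ := t₀) (f := f) hv₀.1 hp)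
  have := hlim.limsup_eq
  simp only [Function.comp_def] at this
  rw [this] at h
  have h' := EReal.coe_le_coe_iff.1 (EReal.coe_zero.trans_le h)
  linarith

/-! ### Estimates for the right-hand side and for the penalization -/

/-- Mean value inequality: for `e ≤ 1` the factor `x^{e-1}` is largest at the left end `a`. It is
applied with `e = m - 1` and `e = m`. -/
lemma abs_rpow_sub_rpow_le {a e s t : ℝ} (ha : 0 < a) (he : e ≤ 1) (hs : a ≤ s) (ht : a ≤ t) :
    |s ^ e - t ^ e| ≤ |e| * a ^ (e - 1) * |s - t| := by
  have := Convex.norm_image_sub_le_of_norm_hasDerivWithin_le (f := fun x : ℝ => x ^ e)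
    (f' := fun x => e * x ^ (e - 1)) (s := Ici a) (C := |e| * a ^ (e - 1)) (x := t) (y := s)
    (fun x hx => (Real.hasDerivAt_rpow_const (Or.inl (ha.trans_le hx).ne')).hasDerivWithinAt)
    (fun x hx => ?_) (convex_Ici a) ht hs
  · simpa using this
  · have hx' : a ≤ x := hx
    rw [norm_mul, Real.norm_eq_abs, Real.norm_eq_abs,
      abs_of_nonneg (Real.rpow_nonneg (ha.le.trans hx') _)]
    exact mul_le_mul_of_nonneg_left (Real.rpow_le_rpow_of_nonpos ha hx' (by linarith))
      (abs_nonneg _)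

/-- Continuity of the right-hand side in the point and the slope, for slopes bounded below. -/
lemma exists_rhs_sub_le {n : ℕ} [NeZero n] {m R : ℝ} (hm0 : 0 < m) (hm1 : m < 1) (hR : 0 < R)
    {V : EuclideanSpace ℝ (Fin n) → ℝ} (hV : IsW2Infty R V) {α β c : ℝ} (hα : 0 < α)
    (hβ : β < ballVol n R) (hc : 0 < c) :
    ∃ C, 0 ≤ C ∧ ∀ v₁ ∈ Icc α β, ∀ v₂ ∈ Icc α β, ∀ p q X : ℝ, c ≤ p → |q| ≤ c / 2 →
      rhs m V v₁ p X - rhs m V v₂ (p - q) X ≤ C * (|X| * |q| + |q| + |v₁ - v₂| * p) := by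
  obtain ⟨L, hL⟩ := exists_lipschitz_powCoeff n m (β := β) hα
  obtain ⟨L', hL'⟩ := exists_lipschitz_driftCoeff m hR hV hα hβ
  obtain ⟨B, hB⟩ := isCompact_Icc.exists_bound_of_continuousOn hL.continuousOn
  obtain ⟨B', hB'⟩ := isCompact_Icc.exists_bound_of_continuousOn hL'.continuousOn
  -- Both slopes `p` and `p - q` stay above `c/2`.
  set a := c / 2 with ha
  have ha0 : 0 < a := by positivity
  set K₁ := |m - 1| * a ^ (m - 1 - 1) with hK₁
  set K₂ := |m| * a ^ (m - 1) with hK₂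
  have hK₁0 : 0 ≤ K₁ := by positivity
  have hK₂0 : 0 ≤ K₂ := by positivity
  refine ⟨m * K₁ + |B| * K₂ + L * c ^ (m - 1) + |B'| + L', by positivity,
    fun v₁ hv₁ v₂ hv₂ p q X hp hq => ?_⟩
  have hp0 : 0 < p := hc.trans_le hp
  have hq' := abs_le.1 hq
  have e1 : |p ^ (m - 1) - (p - q) ^ (m - 1)| ≤ K₁ * |q| := by
    have := abs_rpow_sub_rpow_le (e := m - 1) (s := p) (t := p - q) ha0 (by linarith)
      (by linarith) (by linarith)
    simpa using this
  have e2 : |p ^ m - (p - q) ^ m| ≤ K₂ * |q| := by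
    have := abs_rpow_sub_rpow_le (e := m) (s := p) (t := p - q) ha0 hm1.le
      (by linarith) (by linarith)
    simpa using this
  have e3 : p ^ m ≤ c ^ (m - 1) * p := by
    have : p ^ m = p ^ (m - 1) * p := by rw [Real.rpow_sub_one hp0.ne']; field_simp
    rw [this]
    exact mul_le_mul_of_nonneg_right (Real.rpow_le_rpow_of_nonpos hc hp (by linarith)) hp0.le
  have e4 := hL.dist_le_mul v₁ hv₁ v₂ hv₂
  have e5 := hL'.dist_le_mul v₁ hv₁ v₂ hv₂
  rw [Real.dist_eq, Real.dist_eq] at e4 e5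
  have e6 : |powCoeff n m v₂| ≤ |B| := (hB v₂ hv₂).trans (le_abs_self B)
  have e7 : |driftCoeff m V v₂| ≤ |B'| := (hB' v₂ hv₂).trans (le_abs_self B')
  -- `X` is multiplied only by a difference of powers of the slopes, never by a difference in `v`;
  -- this is the gain from the stretched variable.
  have split : rhs m V v₁ p X - rhs m V v₂ (p - q) X
      = m * (X * (p ^ (m - 1) - (p - q) ^ (m - 1)))
        + (powCoeff n m v₁ - powCoeff n m v₂) * p ^ m
        + powCoeff n m v₂ * (p ^ m - (p - q) ^ m)
        + (driftCoeff m V v₁ - driftCoeff m V v₂) * p + driftCoeff m V v₂ * q := by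
    simp only [rhs]; ring
  rw [split]
  have f1 : m * (X * (p ^ (m - 1) - (p - q) ^ (m - 1))) ≤ m * (|X| * (K₁ * |q|)) := by
    refine mul_le_mul_of_nonneg_left ((le_abs_self _).trans ?_) hm0.le
    rw [abs_mul]; gcongr
  have f2 : (powCoeff n m v₁ - powCoeff n m v₂) * p ^ m
      ≤ (L * |v₁ - v₂|) * (c ^ (m - 1) * p) :=
    mul_le_mul ((le_abs_self _).trans e4) e3 (Real.rpow_nonneg hp0.le _) (by positivity)
  have f3 : powCoeff n m v₂ * (p ^ m - (p - q) ^ m) ≤ |B| * (K₂ * |q|) := by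
    refine (le_abs_self _).trans ?_
    rw [abs_mul]; gcongr
  have f4 : (driftCoeff m V v₁ - driftCoeff m V v₂) * p ≤ (L' * |v₁ - v₂|) * p :=
    mul_le_mul_of_nonneg_right ((le_abs_self _).trans e5) hp0.le
  have f5 : driftCoeff m V v₂ * q ≤ |B'| * |q| := by
    refine (le_abs_self _).trans ?_
    rw [abs_mul]; gcongr
  set Cc := L * c ^ (m - 1) with hCc
  have hCc0 : 0 ≤ Cc := by positivity
  have g1 : 0 ≤ |X| * |q| := by positivity
  have g2 : 0 ≤ |q| := abs_nonneg _
  have g3 : 0 ≤ |v₁ - v₂| * p := by positivity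
  have hL0 : (0 : ℝ) ≤ L' := L'.2
  have k1 : 0 ≤ m * K₁ := by positivity
  have k2 : 0 ≤ |B| * K₂ := by positivity
  calc _ ≤ m * (|X| * (K₁ * |q|)) + (L * |v₁ - v₂|) * (c ^ (m - 1) * p) + |B| * (K₂ * |q|)
        + (L' * |v₁ - v₂|) * p + |B'| * |q| := by linarith
    _ = (m * K₁) * (|X| * |q|) + (|B| * K₂ + |B'|) * |q| + (Cc + L') * (|v₁ - v₂| * p) := by
        rw [hCc]; ring
    _ ≤ (m * K₁ + |B| * K₂ + Cc + |B'| + L') * (|X| * |q|)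
        + (m * K₁ + |B| * K₂ + Cc + |B'| + L') * |q|
        + (m * K₁ + |B| * K₂ + Cc + |B'| + L') * (|v₁ - v₂| * p) := by
        have := abs_nonneg B'
        refine add_le_add (add_le_add ?_ ?_) ?_ <;>
          refine mul_le_mul_of_nonneg_right ?_ (by positivity) <;> linarith
    _ = _ := by ring

/-- The penalization is controlled by the oscillation of `w`, and the maximum of the doubled
functional is almost as large as `u - w`. -/
lemma doubling_estimates {D : Set (ℝ × ℝ)} {u w : ℝ × ℝ → ℝ} {Ψ : ℝ × ℝ → ℝ × ℝ} {δ : ℝ}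
    (hδ : 0 < δ) {ζ₁ ζ₂ z q G : ℝ × ℝ} (h1 : ζ₁ ∈ D) (hq : ‖q‖ ≤ 1)
    (hG1 : Ψ ζ₁ - z = δ • G)
    (hmax : ∀ ξ₁ ∈ D, ∀ ξ₂ ∈ D, ∀ y,
      doubling u w Ψ δ q ξ₁ ξ₂ y ≤ doubling u w Ψ δ q ζ₁ ζ₂ z) :
    δ * dot G G ≤ 4 * (w ζ₁ - w ζ₂) + 8 * δ ∧
      ∀ ξ ∈ D, u ξ - w ξ + dot q (z - Ψ ξ) ≤ u ζ₁ - w ζ₂ := by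
  have hz : ∀ a : ℝ × ℝ, dot (a - a) (a - a) = 0 := fun a => by simp [dot]
  have n1 : dot (z - Ψ ζ₁) (z - Ψ ζ₁) / (2 * δ) = δ * dot G G / 2 := by
    have : z - Ψ ζ₁ = -(δ • G) := by rw [← hG1]; abel
    rw [this]; simp only [dot, Prod.fst_neg, Prod.snd_neg, Prod.smul_fst, Prod.smul_snd,
      smul_eq_mul]; field_simp
  have n2 : 0 ≤ dot (z - Ψ ζ₂) (z - Ψ ζ₂) / (2 * δ) :=
    div_nonneg (dot_self_nonneg _) (by positivity)
  have n3 := mul_nonneg hδ.le (dot_self_nonneg G)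
  constructor
  -- With all three points merged the penalty vanishes; Young's inequality then absorbs `δ q·G` into
  -- half of the penalty.
  · have h := hmax ζ₁ h1 ζ₁ h1 (Ψ ζ₁)
    simp only [doubling, hz, zero_div, n1] at h
    have e : dot q (Ψ ζ₁) - dot q z = δ * dot q G := by
      rw [← dot_sub_right, hG1, dot_smul_right]
    have hb : dot q G ≤ 2 + dot G G / 4 := by
      have b1 := (norm_fst_le q).trans hq
      have b2 := (norm_snd_le q).trans hq
      rw [Real.norm_eq_abs, abs_le] at b1 b2
      simp only [dot]
      nlinarith [sq_nonneg (G.1 - 2 * q.1), sq_nonneg (G.2 - 2 * q.2)]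
    have := mul_le_mul_of_nonneg_left hb hδ.le
    nlinarith
  · intro ξ hξ
    have h := hmax ξ hξ ξ hξ (Ψ ξ)
    simp only [doubling, hz, zero_div, n1] at h
    rw [dot_sub_right]
    linarith

/-! ### No interior maximum for a strict subsolution -/

/-- The coordinates `(t, Y(v))`. -/
def planeMap (n : ℕ) (m : ℝ) (ζ : ℝ × ℝ) : ℝ × ℝ := (ζ.1, stretched n m ζ.2)

lemma tendsto_planeMap_sub (n : ℕ) [NeZero n] (m : ℝ) {ζ : ℝ × ℝ} (hζ : 0 < ζ.2) :
    Tendsto (fun ξ => planeMap n m ξ - planeMap n m ζ) (𝓝 ζ) (𝓝 0) := by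
  have h : ContinuousAt (fun ξ : ℝ × ℝ => planeMap n m ξ - planeMap n m ζ) ζ := by
    refine ContinuousAt.sub (ContinuousAt.prodMk continuousAt_fst ?_) continuousAt_const
    exact ContinuousAt.comp (f := Prod.snd) (hasDerivAt_stretched n m hζ).continuousAt
      continuousAt_snd
  simpa [ContinuousAt] using h

lemma exists_stretch_bounds (n : ℕ) [NeZero n] (m : ℝ) {α β : ℝ} (hα : 0 < α) (hαβ : α ≤ β) :
    ∃ b B, 0 < b ∧ ∀ v ∈ Icc α β, b ≤ stretch n m v ∧ stretch n m v ≤ B := by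
  have hc : ContinuousOn (stretch n m) (Icc α β) :=
    (contDiffOn_stretch n m).continuousOn.mono fun _ hx => hα.trans_le hx.1
  obtain ⟨x, hx, hmin⟩ := isCompact_Icc.exists_isMinOn (nonempty_Icc.2 hαβ) hc
  obtain ⟨y, hy, hmax⟩ := isCompact_Icc.exists_isMaxOn (nonempty_Icc.2 hαβ) hc
  exact ⟨_, _, stretch_pos n m (hα.trans_le hx.1), fun v hv => ⟨hmin hv, hmax hv⟩⟩

lemma mul_abs_sub_le_stretched (n : ℕ) [NeZero n] (m : ℝ) {α β b : ℝ} (hα : 0 < α)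
    (hb : ∀ v ∈ Icc α β, b ≤ stretch n m v) {v w : ℝ} (hv : v ∈ Icc α β) (hw : w ∈ Icc α β) :
    b * |v - w| ≤ |stretched n m v - stretched n m w| := by
  wlog h : w ≤ v generalizing v w
  · rw [abs_sub_comm v, abs_sub_comm (stretched n m v)]
    exact this hw hv (le_of_not_ge h)
  have hpos : ∀ x ∈ Icc α β, 0 < x := fun x hx => hα.trans_le hx.1
  have := (convex_Icc α β).mul_sub_le_image_sub_of_le_deriv (f := stretched n m) (C := b)
    (fun x hx => (hasDerivAt_stretched n m (hpos x hx)).continuousAt.continuousWithinAt)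
    (fun x hx => (hasDerivAt_stretched n m
      (hpos x (interior_subset hx))).differentiableAt.differentiableWithinAt)
    (fun x hx => by
      rw [deriv_stretched n m (hpos x (interior_subset hx))]
      exact hb x (interior_subset hx)) w hw v hv h
  rw [abs_of_nonneg (sub_nonneg.2 h)]
  exact this.trans (le_abs_self _)

/-- A function touched from above by a parabola in the stretched variable inherits its lower slope
bound to the parabola. -/
lemma le_mul_of_touching (n : ℕ) [NeZero n] (m : ℝ) {g : ℝ → ℝ} {v₀ p X c β : ℝ} (hv₀ : 0 < v₀)
    (hβ : v₀ < β) (hg : ∀ v ∈ Icc v₀ β, c * (v - v₀) ≤ g v - g v₀)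
    (hle : ∀ᶠ v in 𝓝 v₀, g v ≤ g v₀ + p * (stretched n m v - stretched n m v₀)
      + X * (stretched n m v - stretched n m v₀) ^ 2) : c ≤ stretch n m v₀ * p := by
  set k : ℝ → ℝ := fun v => p * (stretched n m v - stretched n m v₀)
      + X * (stretched n m v - stretched n m v₀) ^ 2 with hk
  have hd : HasDerivAt k (stretch n m v₀ * p) v₀ := by
    have h := (hasDerivAt_stretched n m hv₀).sub_const (stretched n m v₀)
    refine ((h.const_mul p).add ((h.pow 2).const_mul X)).congr_deriv ?_
    simp; ring
  have ht := (hasDerivAt_iff_tendsto_slope.1 hd).mono_left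
    (nhdsWithin_mono v₀ (s := Ioi v₀) fun x (hx : v₀ < x) => hx.ne')
  refine ge_of_tendsto ht ?_
  filter_upwards [hle.filter_mono nhdsWithin_le_nhds, Ioo_mem_nhdsGT hβ] with v h1 h2
  have h3 := hg v ⟨h2.1.le, h2.2.le⟩
  have hk0 : k v₀ = 0 := by simp [hk]
  rw [slope_def_field, hk0, sub_zero, le_div_iff₀ (sub_pos.2 h2.1)]
  simp only [hk]
  linarith

lemma rhs_add {n : ℕ} [NeZero n] (m : ℝ) (V : EuclideanSpace ℝ (Fin n) → ℝ) (v p X Z : ℝ) :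
    rhs m V v p (X + Z) = rhs m V v p X + m * p ^ (m - 1) * Z := by
  simp only [rhs]; ring

lemma tendsto_rhs_add {n : ℕ} [NeZero n] (m : ℝ) (V : EuclideanSpace ℝ (Fin n) → ℝ)
    (v p X k : ℝ) : Tendsto (fun η => rhs m V v p (X + k * η)) (𝓝[>] 0) (𝓝 (rhs m V v p X)) := by
  have : Continuous fun η => rhs m V v p (X + k * η) := by
    simp only [rhs_add]; fun_prop
  simpa using (this.tendsto 0).mono_left nhdsWithin_le_nhds

/-- A subsolution touched from above, up to a function `P` of time, by a parabola in the
stretched variable. -/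
lemma IsViscositySubsolution.add_le_rhs {n : ℕ} [NeZero n] {m R : ℝ} (hm : 0 < m)
    {V : EuclideanSpace ℝ (Fin n) → ℝ} {M : ℝ → ℝ → ℝ} (hM : IsViscositySubsolution m R V M)
    {P : ℝ → ℝ} (hP : ContDiff ℝ 2 P) {D : Set (ℝ × ℝ)} {ζ G : ℝ × ℝ} {X : ℝ} (hD : D ∈ 𝓝 ζ)
    (ht : 0 < ζ.1) (hv : ζ.2 ∈ Ioo 0 (ballVol n R)) (hp : 0 < G.2)
    (hjet : ∀ η > 0, ∃ B, ∀ᶠ h in 𝓝 (0 : ℝ × ℝ),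
      ∀ ξ ∈ D, planeMap n m ξ = planeMap n m ζ + h → M ξ.1 ξ.2 - P ξ.1
        ≤ M ζ.1 ζ.2 - P ζ.1 + dot G h + (1 / 2 * X + η) * h.2 ^ 2 + B * h.1 ^ 2) :
    deriv P ζ.1 + G.1 ≤ rhs m V ζ.2 G.2 X := by
  refine ge_of_tendsto (tendsto_rhs_add m V ζ.2 G.2 X 2) ?_
  filter_upwards [self_mem_nhdsWithin] with η hη
  obtain ⟨B, hB⟩ := hjet η hη
  -- The term with `B` is quadratic in time and does not affect the derivative at `ζ.1`.
  set f : ℝ → ℝ := fun t => M ζ.1 ζ.2 + (P t - P ζ.1) + G.1 * (t - ζ.1) + B * (t - ζ.1) ^ 2 with hf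
  have hfc : ContDiff ℝ 2 f := by fun_prop
  have hfd : deriv f ζ.1 = deriv P ζ.1 + G.1 := by
    have h1 : HasDerivAt P (deriv P ζ.1) ζ.1 :=
      (hP.differentiable (by norm_num)).differentiableAt.hasDerivAt
    have h2 : HasDerivAt (fun t : ℝ => t - ζ.1) 1 ζ.1 := (hasDerivAt_id _).sub_const _
    have h3 := (((h1.sub_const (P ζ.1)).const_add (M ζ.1 ζ.2)).add (h2.const_mul G.1)).add
      ((h2.pow 2).const_mul B)
    rw [HasDerivAt.deriv (f := f) h3]
    simp
  rw [← hfd]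
  refine hM.le_rhs hm hfc ht hv hp (by simp [hf]) ?_
  filter_upwards [(tendsto_planeMap_sub n m hv.1).eventually hB, hD] with ξ h1 h2
  have h3 := h1 ξ h2 (by abel)
  simp only [planeMap, dot, Prod.fst_sub, Prod.snd_sub] at h3
  simp only [hf, jetTest]
  linarith

/-- A supersolution touched from below by a parabola in the stretched variable. -/
lemma IsViscositySupersolution.rhs_le_fst {n : ℕ} [NeZero n] {m R : ℝ} (hm : 0 < m)
    {V : EuclideanSpace ℝ (Fin n) → ℝ} {M : ℝ → ℝ → ℝ} (hM : IsViscositySupersolution m R V M)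
    {D : Set (ℝ × ℝ)} {ζ G : ℝ × ℝ} {X : ℝ} (hD : D ∈ 𝓝 ζ)
    (ht : 0 < ζ.1) (hv : ζ.2 ∈ Ioo 0 (ballVol n R)) (hp : 0 < G.2)
    (hjet : ∀ η > 0, ∃ B, ∀ᶠ h in 𝓝 (0 : ℝ × ℝ),
      ∀ ξ ∈ D, planeMap n m ξ = planeMap n m ζ + h →
        M ζ.1 ζ.2 + dot G h + (1 / 2 * X - η) * h.2 ^ 2 - B * h.1 ^ 2 ≤ M ξ.1 ξ.2) :
    rhs m V ζ.2 G.2 X ≤ G.1 := by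
  refine le_of_tendsto (tendsto_rhs_add m V ζ.2 G.2 X (-2)) ?_
  filter_upwards [self_mem_nhdsWithin] with η hη
  obtain ⟨B, hB⟩ := hjet η hη
  set f : ℝ → ℝ := fun t => M ζ.1 ζ.2 + G.1 * (t - ζ.1) + (-B) * (t - ζ.1) ^ 2 with hf
  have hfc : ContDiff ℝ 2 f := by fun_prop
  have hfd : deriv f ζ.1 = G.1 := by
    have h2 : HasDerivAt (fun t : ℝ => t - ζ.1) 1 ζ.1 := (hasDerivAt_id _).sub_const _
    have h3 := ((h2.const_mul G.1).const_add (M ζ.1 ζ.2)).add ((h2.pow 2).const_mul (-B))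
    rw [HasDerivAt.deriv (f := f) h3]
    simp
  rw [← hfd]
  refine hM.rhs_le hm hfc ht hv hp (by simp [hf]) ?_
  filter_upwards [(tendsto_planeMap_sub n m hv.1).eventually hB, hD] with ξ h1 h2
  have h3 := h1 ξ h2 (by abel)
  simp only [planeMap, dot, Prod.fst_sub, Prod.snd_sub] at h3
  simp only [hf, jetTest]
  linarith

set_option maxHeartbeats 1000000 in
/-- A strict subsolution `u = Msub - P` with slopes bounded below minus a supersolution cannot have
its maximum over a box only in the interior. -/
theorem false_of_interior_max {n : ℕ} [NeZero n] {m R : ℝ} (hm0 : 0 < m) (hm1 : m < 1)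
    (hR : 0 < R) {V : EuclideanSpace ℝ (Fin n) → ℝ} (hV : IsW2Infty R V)
    {Msub Msup : ℝ → ℝ → ℝ} (hsub : IsViscositySubsolution m R V Msub)
    (hsup : IsViscositySupersolution m R V Msup) {τ T α β : ℝ} (hτ : 0 < τ) (hα : 0 < α)
    (hβ : β < ballVol n R)
    (hcsub : ContinuousOn (fun ζ : ℝ × ℝ => Msub ζ.1 ζ.2) (Icc τ T ×ˢ Icc α β))
    (hcsup : ContinuousOn (fun ζ : ℝ × ℝ => Msup ζ.1 ζ.2) (Icc τ T ×ˢ Icc α β))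
    {C₀ : ℝ} (hC₀ : 0 < C₀) (hslope : ∀ t ∈ Icc τ T, ∀ v₁ ∈ Icc α β, ∀ v₂ ∈ Icc α β,
      v₁ ≤ v₂ → C₀ * (v₂ - v₁) ≤ Msub t v₂ - Msub t v₁)
    {P : ℝ → ℝ} (hP : ContDiff ℝ 2 P) {lam : ℝ} (hlam : 0 < lam)
    (hPd : ∀ t ∈ Icc τ T, lam ≤ deriv P t)
    {ζ₀ : ℝ × ℝ} (hζ₀ : ζ₀ ∈ Icc τ T ×ˢ Icc α β) {ε₀ : ℝ} (hε₀ : 0 < ε₀)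
    (hint : ∀ ζ ∈ Icc τ T ×ˢ Icc α β,
      (Msub ζ₀.1 ζ₀.2 - P ζ₀.1) - Msup ζ₀.1 ζ₀.2 - ε₀ ≤ (Msub ζ.1 ζ.2 - P ζ.1) - Msup ζ.1 ζ.2 →
      ζ ∈ Ioo τ T ×ˢ Ioo α β) : False := by
  set D : Set (ℝ × ℝ) := Icc τ T ×ˢ Icc α β with hDdef
  set Ψ := planeMap n m with hΨdef
  set u : ℝ × ℝ → ℝ := fun ζ => Msub ζ.1 ζ.2 - P ζ.1 with hu
  set w : ℝ × ℝ → ℝ := fun ζ => Msup ζ.1 ζ.2 with hw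
  have hD : IsCompact D := isCompact_Icc.prod isCompact_Icc
  have hne : D.Nonempty := ⟨ζ₀, hζ₀⟩
  have hαβ : α ≤ β := hζ₀.2.1.trans hζ₀.2.2
  have huc : ContinuousOn u D := hcsub.sub (hP.continuous.comp continuous_fst).continuousOn
  have hwc : ContinuousOn w D := hcsup
  have hYc : ContinuousOn (stretched n m) (Icc α β) := fun x hx =>
    (hasDerivAt_stretched n m (hα.trans_le hx.1)).continuousAt.continuousWithinAt
  have hΨc : ContinuousOn Ψ D :=
    continuousOn_fst.prodMk (hYc.comp continuousOn_snd fun ζ hζ => hζ.2)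
  obtain ⟨b, Bh, hb, hbB⟩ := exists_stretch_bounds n m hα hαβ
  have hBh : 0 < Bh := hb.trans_le ((hbB α ⟨le_rfl, hαβ⟩).1.trans (hbB α ⟨le_rfl, hαβ⟩).2)
  -- The slope in `Y` is the slope in `v` divided by `Y' ≤ Bh`.
  set c := C₀ / Bh with hc
  have hc0 : 0 < c := by positivity
  obtain ⟨C, hC0, hC⟩ := exists_rhs_sub_le hm0 hm1 hR hV hα hβ hc0
  obtain ⟨W, hW⟩ := hD.exists_bound_of_continuousOn hwc
  obtain ⟨S, hS⟩ := hD.exists_bound_of_continuousOn hΨc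
  have hW0 : 0 ≤ W := (norm_nonneg _).trans (hW ζ₀ hζ₀)
  have hS0 : 0 ≤ S := (norm_nonneg _).trans (hS ζ₀ hζ₀)
  -- `3ε ≤ ε₀` keeps both maximum points almost optimal; the last condition makes the term `C |v₁ -
  -- v₂| p` cost at most half of the strictness `lam`.
  obtain ⟨ε, hε, hε1, hε2⟩ : ∃ ε, 0 < ε ∧ 3 * ε ≤ ε₀ ∧ C * (3 / b * (8 * ε)) ≤ lam / 2 := by
    refine ⟨min (ε₀ / 3) (lam * b / (48 * (C + 1))), by positivity, ?_, ?_⟩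
    · linarith [min_le_left (ε₀ / 3) (lam * b / (48 * (C + 1)))]
    · calc C * (3 / b * (8 * min (ε₀ / 3) (lam * b / (48 * (C + 1)))))
          ≤ (C + 1) * (3 / b * (8 * (lam * b / (48 * (C + 1))))) := by
            gcongr
            · linarith
            · exact min_le_right _ _
        _ = lam / 2 := by field_simp; norm_num
  obtain ⟨s₁, hs₁, hus⟩ := Metric.uniformContinuousOn_iff.1
    (hD.uniformContinuousOn_of_continuous huc) ε hε
  obtain ⟨s₂, hs₂, hws⟩ := Metric.uniformContinuousOn_iff.1
    (hD.uniformContinuousOn_of_continuous hwc) ε hε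
  -- This bounds the distance between `ζ₁` and `ζ₂`: `8W + 8` arises from `4 (w ζ₁ - w ζ₂) + 8δ`
  -- with `|w| ≤ W` and `δ < 1`, and `1/b` converts distances in `Y` to distances in `v`.
  set k : ℝ → ℝ := fun δ => (1 + 1 / b) * (2 * √(δ * (8 * W + 8)) + δ) with hk
  have hkc : Tendsto k (𝓝[>] 0) (𝓝 0) := by
    have : Continuous k := by fun_prop
    simpa [hk] using (this.tendsto 0).mono_left nhdsWithin_le_nhds
  obtain ⟨δ, hδk, hδε⟩ := ((hkc.eventually (gt_mem_nhds (lt_min (lt_min hs₁ hs₂) one_pos))).and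
    (Ioo_mem_nhdsGT (lt_min one_pos (by positivity : 0 < ε / 2)))).exists
  obtain ⟨hδ0, hδ1⟩ := hδε
  rw [lt_min_iff] at hδ1
  rw [lt_min_iff, lt_min_iff] at hδk
  obtain ⟨⟨hδs₁, hδs₂⟩, hδk1⟩ := hδk
  -- The size `r` of the perturbation is chosen after `δ`, since `|X| |q|` is only bounded by
  -- `2r/δ`.
  have hrlim : Tendsto (fun r => C * (2 / δ * r + r) + r + 2 * r * (2 * S + 1)) (𝓝[>] 0)
      (𝓝 0) := by
    have : Continuous fun r => C * (2 / δ * r + r) + r + 2 * r * (2 * S + 1) := by fun_prop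
    simpa using (this.tendsto 0).mono_left nhdsWithin_le_nhds
  obtain ⟨r, hr, hr'⟩ := ((hrlim.eventually (gt_mem_nhds (lt_min hε (half_pos hlam)))).and
    (Ioo_mem_nhdsGT (lt_min one_pos (half_pos hc0)))).exists
  obtain ⟨hr0, hr1⟩ := hr'
  rw [lt_min_iff] at hr1 hr
  obtain ⟨ζ₁, hζ₁, ζ₂, hζ₂, z, q, G, X, hq, hG1, hG2, hX, hmax, hjet⟩ :=
    exists_doubling_jets hD hne huc hwc hΨc hδ0 hr0
  obtain ⟨hQ, hval⟩ := doubling_estimates hδ0 hζ₁ (hq.le.trans hr1.1.le) hG1 hmax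
  have hq1 : |q.1| < r := (norm_fst_le q).trans_lt hq
  have hq2 : |q.2| < r := (norm_snd_le q).trans_lt hq
  -- the points of maximum are close to each other
  have hdotG : dot G G = G.1 ^ 2 + G.2 ^ 2 := by simp [dot]; ring
  set κ₀ := √(δ * (8 * W + 8)) with hκ₀
  have hκ0 : 0 ≤ κ₀ := Real.sqrt_nonneg _
  have hGb : ∀ x, x ^ 2 ≤ dot G G → |δ * x| ≤ κ₀ := by
    intro x hx
    refine Real.abs_le_sqrt ?_
    have h1 := (abs_le.1 (hW ζ₁ hζ₁)).2
    have h2 := (abs_le.1 (hW ζ₂ hζ₂)).1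
    have h3 : δ * x ^ 2 ≤ δ * dot G G := mul_le_mul_of_nonneg_left hx hδ0.le
    have h4 : δ * x ^ 2 ≤ 8 * W + 8 := by linarith [hδ1.1]
    calc (δ * x) ^ 2 = δ * (δ * x ^ 2) := by ring
      _ ≤ δ * (8 * W + 8) := by gcongr
  have hg1 := hGb G.1 (hdotG ▸ le_add_of_nonneg_right (sq_nonneg _))
  have hg2 := hGb G.2 (hdotG ▸ le_add_of_nonneg_left (sq_nonneg _))
  have hdiff : Ψ ζ₁ - Ψ ζ₂ = δ • ((2 : ℝ) • G - q) := by
    have : Ψ ζ₁ - Ψ ζ₂ = (Ψ ζ₁ - z) + (z - Ψ ζ₂) := by abel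
    rw [this, hG1, hG2, ← smul_add, two_smul]; congr 1; abel
  have hd1 : ζ₁.1 - ζ₂.1 = δ * (2 * G.1 - q.1) := congrArg Prod.fst hdiff
  have hd2 : stretched n m ζ₁.2 - stretched n m ζ₂.2 = δ * (2 * G.2 - q.2) :=
    congrArg Prod.snd hdiff
  have hcomp : ∀ x y : ℝ, |δ * x| ≤ κ₀ → |y| < r → |δ * (2 * x - y)| ≤ 2 * κ₀ + δ := by
    intro x y hx hy
    have h1 : |δ * y| ≤ δ := by
      rw [abs_mul, abs_of_pos hδ0]
      exact mul_le_of_le_one_right hδ0.le (by linarith [hr1.1])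
    have : δ * (2 * x - y) = 2 * (δ * x) - δ * y := by ring
    rw [this]
    rw [abs_le] at *
    constructor <;> linarith [hx.1, hx.2, h1.1, h1.2]
  have hvv := mul_abs_sub_le_stretched n m hα (fun v hv => (hbB v hv).1) hζ₁.2 hζ₂.2
  rw [hd2] at hvv
  have hbinv : 0 < 1 / b := by positivity
  have hdist : dist ζ₁ ζ₂ ≤ k δ := by
    have hkκ : k δ = (2 * κ₀ + δ) + 1 / b * (2 * κ₀ + δ) := one_add_mul _ _
    have h0 : 0 ≤ 2 * κ₀ + δ := by positivity
    have h0' := mul_nonneg hbinv.le h0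
    rw [Prod.dist_eq, Real.dist_eq, Real.dist_eq, hd1, max_le_iff, hkκ]
    constructor
    · linarith [hcomp _ _ hg1 hq1]
    · have h1 := hvv.trans (hcomp _ _ hg2 hq2)
      have h2 : |ζ₁.2 - ζ₂.2| ≤ 1 / b * (2 * κ₀ + δ) := by
        rw [one_div, ← div_eq_inv_mul, le_div_iff₀ hb]; linarith
      linarith
  have hwd := hws ζ₁ hζ₁ ζ₂ hζ₂ (hdist.trans_lt hδs₂)
  have hud := hus ζ₁ hζ₁ ζ₂ hζ₂ (hdist.trans_lt hδs₁)
  rw [Real.dist_eq, abs_lt] at hwd hud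
  -- hence they lie in the interior of the box
  have hval₀ := hval ζ₀ hζ₀
  have hzΨ : |dot q (z - Ψ ζ₀)| ≤ 2 * r * (2 * S + 1) := by
    have h1 : ‖z - Ψ ζ₀‖ ≤ 2 * S + 1 := by
      have e : z - Ψ ζ₀ = Ψ ζ₁ - Ψ ζ₀ - δ • G := by rw [← hG1]; abel
      have h2 : ‖δ • G‖ ≤ 1 := by
        have hκ1 : κ₀ ≤ 1 := by
          have hkκ : k δ = (2 * κ₀ + δ) + 1 / b * (2 * κ₀ + δ) := one_add_mul _ _
          have h0' := mul_nonneg hbinv.le (by positivity : 0 ≤ 2 * κ₀ + δ)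
          linarith
        rw [Prod.norm_def, max_le_iff]
        exact ⟨hg1.trans hκ1, hg2.trans hκ1⟩
      rw [e]
      linarith [norm_sub_le (Ψ ζ₁ - Ψ ζ₀) (δ • G), norm_sub_le (Ψ ζ₁) (Ψ ζ₀), hS ζ₁ hζ₁,
        hS ζ₀ hζ₀]
    refine (abs_dot_le _ _).trans ?_
    rw [mul_assoc]
    gcongr
  have hrest : 0 ≤ C * (2 / δ * r + r) + r := by positivity
  have hrest' : 0 ≤ 2 * r * (2 * S + 1) := by positivity
  have hzΨ' := (abs_le.1 hzΨ).1
  have hin₁ : ζ₁ ∈ Ioo τ T ×ˢ Ioo α β := hint ζ₁ hζ₁ (by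
    change u ζ₀ - w ζ₀ - ε₀ ≤ u ζ₁ - w ζ₁
    linarith [hr.1, hwd.1, hwd.2])
  have hin₂ : ζ₂ ∈ Ioo τ T ×ˢ Ioo α β := hint ζ₂ hζ₂ (by
    change u ζ₀ - w ζ₀ - ε₀ ≤ u ζ₂ - w ζ₂
    linarith [hr.1, hud.1, hud.2])
  have hnhds : ∀ ζ ∈ Ioo τ T ×ˢ Ioo α β, D ∈ 𝓝 ζ := fun ζ hζ =>
    prod_mem_nhds (Icc_mem_nhds hζ.1.1 hζ.1.2) (Icc_mem_nhds hζ.2.1 hζ.2.2)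
  -- the slope of the test parabolas
  have hp : c ≤ G.2 := by
    have hv0 : 0 < ζ₁.2 := hα.trans hin₁.2.1
    have h1 : C₀ ≤ stretch n m ζ₁.2 * G.2 := by
      obtain ⟨B, hB⟩ := hjet 1 one_pos
      refine le_mul_of_touching n m (g := fun v => Msub ζ₁.1 v) (X := 1 / 2 * X + 1) hv0 hin₁.2.2
        (fun v hv => hslope _ hζ₁.1 _ hζ₁.2 _ ⟨hζ₁.2.1.trans hv.1, hv.2⟩ hv.1) ?_
      have ht : Tendsto (fun v : ℝ => (ζ₁.1, v)) (𝓝 ζ₁.2) (𝓝 ζ₁) :=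
        (by fun_prop : Continuous fun v : ℝ => (ζ₁.1, v)).tendsto ζ₁.2
      filter_upwards [ht.eventually ((tendsto_planeMap_sub n m hv0).eventually hB),
        ht.eventually (hnhds ζ₁ hin₁)] with v h1 h2
      have h3 := h1.1 (ζ₁.1, v) h2 (by rw [hΨdef]; abel)
      simp only [hu, planeMap, dot, Prod.fst_sub, Prod.snd_sub] at h3
      linarith
    have hst := hbB _ hζ₁.2
    rw [hc, div_le_iff₀ hBh]
    have hG0 : 0 < G.2 := by
      exact pos_of_mul_pos_right (hC₀.trans_le h1) (hb.le.trans hst.1)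
    rw [mul_comm]
    exact h1.trans (mul_le_mul_of_nonneg_right hst.2 hG0.le)
  have hG0 : 0 < G.2 := hc0.trans_le hp
  have hq2c : |q.2| ≤ c / 2 := hq2.le.trans hr1.2.le
  have hp' : 0 < (G - q).2 := by
    have := (abs_le.1 hq2c).2
    simp only [Prod.snd_sub]; linarith
  -- the two viscosity inequalities
  have hvpos : ∀ ζ ∈ D, 0 < ζ.1 ∧ ζ.2 ∈ Ioo 0 (ballVol n R) := fun ζ hζ =>
    ⟨hτ.trans_le hζ.1.1, hα.trans_le hζ.2.1, hζ.2.2.trans_lt hβ⟩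
  have i1 := hsub.add_le_rhs hm0 hP (X := X) (hnhds ζ₁ hin₁) (hvpos ζ₁ hζ₁).1 (hvpos ζ₁ hζ₁).2
    hG0 (fun η hη => (hjet η hη).imp fun B hB => hB.mono fun h hh => hh.1)
  have i2 := hsup.rhs_le_fst hm0 (X := X) (hnhds ζ₂ hin₂) (hvpos ζ₂ hζ₂).1 (hvpos ζ₂ hζ₂).2
    hp' (fun η hη => (hjet η hη).imp fun B hB => hB.mono fun h hh => hh.2)
  have i3 := hC ζ₁.2 hζ₁.2 ζ₂.2 hζ₂.2 G.2 q.2 X hp hq2c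
  have i4 := hPd ζ₁.1 hζ₁.1
  simp only [Prod.fst_sub, Prod.snd_sub] at i2
  have i5 : |ζ₁.2 - ζ₂.2| * G.2 ≤ 3 / b * (8 * ε) := by
    have j1 : |δ * (2 * G.2 - q.2)| ≤ δ * (3 * G.2) := by
      rw [abs_mul, abs_of_pos hδ0]
      have := abs_le.1 hq2c
      refine mul_le_mul_of_nonneg_left (abs_le.2 ⟨?_, ?_⟩) hδ0.le <;> linarith
    have j2 : δ * G.2 ^ 2 ≤ 8 * ε := by
      have h5 : δ * G.2 ^ 2 ≤ δ * dot G G :=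
        mul_le_mul_of_nonneg_left (hdotG ▸ le_add_of_nonneg_left (sq_nonneg _)) hδ0.le
      linarith [hwd.2, hδ1.2]
    have j3 := mul_le_mul_of_nonneg_right (hvv.trans j1) hG0.le
    rw [div_mul_eq_mul_div, le_div_iff₀ hb]
    linarith
  have i6 : |X| * |q.2| ≤ 2 / δ * r := mul_le_mul hX hq2.le (abs_nonneg _) (by positivity)
  have i7 : C * (|X| * |q.2| + |q.2| + |ζ₁.2 - ζ₂.2| * G.2)
      ≤ C * (2 / δ * r + r) + C * (3 / b * (8 * ε)) := by
    rw [← mul_add]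
    refine mul_le_mul_of_nonneg_left ?_ hC0
    linarith
  have i8 := (abs_lt.1 hq1).1
  -- Subtracting the two inequalities cancels `G.1` and leaves `lam ≤ r + C (2r/δ + r) + lam/2`,
  -- which is less than `lam`.
  linarith [hr.2]

end MassEq

end

/-! ### The comparison principle -/

theorem mainTheorem9 (n : ℕ) [NeZero n] (m : ℝ) (hm0 : 0 < m) (hm1 : m < 1)
    (R : ℝ) (hR : 0 < R)
    (V : EuclideanSpace ℝ (Fin n) → ℝ)
    (hV : MassEq.IsW2Infty R V) (hVrad : MassEq.IsRadialOn R V)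
    (Msub Msup : ℝ → ℝ → ℝ)
    (hsub_uc : UniformContinuousOn (fun p : ℝ × ℝ => Msub p.1 p.2)
      (Ici 0 ×ˢ Icc 0 (MassEq.ballVol n R)))
    (hsup_uc : UniformContinuousOn (fun p : ℝ × ℝ => Msup p.1 p.2)
      (Ici 0 ×ˢ Icc 0 (MassEq.ballVol n R)))
    (hsub : MassEq.IsViscositySubsolution m R V Msub)
    (hsup : MassEq.IsViscositySupersolution m R V Msup)
    (h_init : ∀ v ∈ Icc 0 (MassEq.ballVol n R), Msub 0 v ≤ Msup 0 v)
    (h_left : ∀ t > 0, Msub t 0 ≤ Msup t 0)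
    (h_right : ∀ t > 0, Msub t (MassEq.ballVol n R) ≤ Msup t (MassEq.ballVol n R))
    (C₀ : ℝ) (hC₀ : 0 < C₀)
    (hslope : ∀ t ≥ 0, ∀ v₁ ∈ Icc 0 (MassEq.ballVol n R), ∀ v₂ ∈ Icc 0 (MassEq.ballVol n R),
      v₁ ≤ v₂ → C₀ * (v₂ - v₁) ≤ Msub t v₂ - Msub t v₁) :
    ∀ t ≥ 0, ∀ v ∈ Icc 0 (MassEq.ballVol n R), Msub t v ≤ Msup t v := by
  intro t₀ ht₀ v₀ hv₀
  by_contra hcon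
  set B := MassEq.ballVol n R with hB
  set σ := Msub t₀ v₀ - Msup t₀ v₀ with hσdef
  have hσ : 0 < σ := sub_pos.2 (not_le.1 hcon)
  have hB0 : 0 ≤ B := hv₀.1.trans hv₀.2
  have h_left' : ∀ t ≥ 0, Msub t 0 ≤ Msup t 0 := fun t ht =>
    ht.lt_or_eq.elim (h_left t) fun h => h ▸ h_init 0 ⟨le_rfl, hB0⟩
  have h_right' : ∀ t ≥ 0, Msub t B ≤ Msup t B := fun t ht =>
    ht.lt_or_eq.elim (h_right t) fun h => h ▸ h_init B ⟨hB0, le_rfl⟩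
  obtain ⟨s₁, hs₁, hu⟩ := Metric.uniformContinuousOn_iff.1 hsub_uc (σ / 16) (by positivity)
  obtain ⟨s₂, hs₂, hw⟩ := Metric.uniformContinuousOn_iff.1 hsup_uc (σ / 16) (by positivity)
  obtain ⟨s, hs, hss₁, hss₂⟩ : ∃ s, 0 < s ∧ s < s₁ ∧ s < s₂ :=
    ⟨min s₁ s₂ / 2, by positivity, by linarith [min_le_left s₁ s₂, lt_min hs₁ hs₂],
      by linarith [min_le_right s₁ s₂, lt_min hs₁ hs₂]⟩
  have hclose : ∀ p ∈ Ici (0 : ℝ) ×ˢ Icc 0 B, ∀ q ∈ Ici (0 : ℝ) ×ˢ Icc 0 B, dist p q ≤ s →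
      Msub q.1 q.2 ≤ Msup q.1 q.2 → Msub p.1 p.2 - Msup p.1 p.2 < σ / 8 := by
    intro p hp q hq hd h
    have h1 := hu p hp q hq (hd.trans_lt hss₁)
    have h2 := hw p hp q hq (hd.trans_lt hss₂)
    rw [Real.dist_eq, abs_lt] at h1 h2
    linarith [h1.2, h2.1]
  have hint : ∀ t ≥ 0, ∀ v ∈ Icc 0 B, σ / 8 ≤ Msub t v - Msup t v →
      s < t ∧ v ∈ Ioo s (B - s) := by
    intro t ht v hv h
    refine ⟨?_, ?_, ?_⟩ <;> by_contra hc <;> rw [not_lt] at hc <;> refine h.not_gt ?_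
    · refine hclose (t, v) ⟨ht, hv⟩ (0, v) ⟨self_mem_Ici, hv⟩ ?_ (h_init v hv)
      rw [Prod.dist_eq, dist_self, Real.dist_eq, sub_zero, abs_of_nonneg ht]
      exact max_le hc hs.le
    · refine hclose (t, v) ⟨ht, hv⟩ (t, 0) ⟨ht, le_rfl, hB0⟩ ?_ (h_left' t ht)
      rw [Prod.dist_eq, dist_self, Real.dist_eq, sub_zero, abs_of_nonneg hv.1]
      exact max_le hs.le hc
    · refine hclose (t, v) ⟨ht, hv⟩ (t, B) ⟨ht, hB0, le_rfl⟩ ?_ (h_right' t ht)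
      rw [Prod.dist_eq, dist_self, Real.dist_eq, abs_sub_comm, abs_of_nonneg (sub_nonneg.2 hv.2)]
      exact max_le hs.le (by linarith)
  obtain ⟨hst, hsv⟩ := hint t₀ ht₀ v₀ hv₀ (by linarith)
  have hDsub : Icc s (t₀ + 2) ×ˢ Icc s (B - s) ⊆ Ici (0 : ℝ) ×ˢ Icc 0 B := fun ζ hζ =>
    ⟨hs.le.trans hζ.1.1, hs.le.trans hζ.2.1, hζ.2.2.trans (by linarith)⟩
  have hcsub := hsub_uc.continuousOn.mono hDsub
  have hcsup := hsup_uc.continuousOn.mono hDsub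
  obtain ⟨A, hA⟩ := (isCompact_Icc.prod isCompact_Icc).exists_bound_of_continuousOn
    (hcsub.sub hcsup)
  obtain ⟨N, hN0, hN1, hN2⟩ : ∃ N : ℝ, 0 < N ∧ A < Real.exp N ∧ Real.exp (-N) < σ / 4 :=
    ((eventually_gt_atTop 0).and ((Real.tendsto_exp_atTop.eventually_gt_atTop A).and
      (Real.tendsto_exp_neg_atTop_nhds_zero.eventually
        (gt_mem_nhds (by positivity : 0 < σ / 4))))).exists
  -- Centred at `t₀ + 1`: the value `e^{-N}` at `t₀` costs less than `σ/4`, while `e^N` at the final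
  -- time `t₀ + 2` exceeds every value of `Msub - Msup` on the box. Since `P'` increases, its value
  -- at time 0 serves as the strictness constant.
  set P : ℝ → ℝ := fun t => Real.exp (N * (t - t₀ - 1)) with hP
  have hPd : ∀ t, deriv P t = Real.exp (N * (t - t₀ - 1)) * N := fun t => by
    have h : HasDerivAt (fun t : ℝ => N * (t - t₀ - 1)) (N * 1) t :=
      (((hasDerivAt_id t).sub_const t₀).sub_const 1).const_mul N
    simpa using h.exp.deriv
  refine MassEq.false_of_interior_max hm0 hm1 hR hV hsub hsup hs hs (by linarith) hcsub hcsup hC₀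
    (fun t ht v₁ hv₁ v₂ hv₂ => hslope t (hs.le.trans ht.1) v₁ ?_ v₂ ?_) (P := P) (by fun_prop)
    (lam := Real.exp (N * (0 - t₀ - 1)) * N) (by positivity) (fun t ht => ?_)
    (ζ₀ := (t₀, v₀)) ⟨⟨hst.le, by simp⟩, hsv.1.le, hsv.2.le⟩ (ε₀ := σ / 4) (by positivity) ?_
  · exact ⟨hs.le.trans hv₁.1, hv₁.2.trans (by linarith)⟩
  · exact ⟨hs.le.trans hv₂.1, hv₂.2.trans (by linarith)⟩
  · rw [hPd]
    have := hs.le.trans ht.1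
    gcongr
  · intro ζ hζ h
    have hP₀ : P t₀ = Real.exp (-N) := by simp only [hP]; congr 1; ring
    have hPpos : 0 < P ζ.1 := Real.exp_pos _
    simp only [hP₀] at h
    obtain ⟨h1, h2⟩ := hint ζ.1 (hDsub hζ).1 ζ.2 (hDsub hζ).2 (by linarith)
    refine ⟨⟨h1, lt_of_le_of_ne hζ.1.2 fun hT => ?_⟩, h2⟩
    have hPT : P ζ.1 = Real.exp N := by simp only [hP, hT]; congr 1; ring
    have h3 := (le_abs_self _).trans (hA ζ hζ)
    change Msub ζ.1 ζ.2 - Msup ζ.1 ζ.2 ≤ A at h3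
    linarith
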